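/- Conventions. All algebras are associative algebras over a field $K$, possibly without unit, with non-degenerate product; $M(R)$ is the multiplier algebra of $R$. A multiplier Hopf algebra is an algebra $A$ with a coassociative homomorphism $\Delta:A\to M(A\otimes A)$ such that $T_1(a\otimes b)=\Delta(a)(1\otimes b)=a_{(1)}\otimes a_{(2)}b$ and $T_2(a\otimes b)=(a\otimes 1)\Delta(b)=ab_{(1)}\otimes b_{(2)}$ define bijections of $A\otimes A$ onto itself. It is regular if $(A,\Delta^{cop})$ is also a multiplier Hopf algebra; it then has a bijective antipode $S:A\to A$. Sweedler formulas are understood in the usual covered sense. Let $A,B$ be regular multiplier Hopf algebras over $K$, and let $\langle\cdot,\cdot\rangle:A\times B\to K$ be a pairing. That is, it is a non-degenerate bilinear form such that the multipliers $$(b\blacktriangleright a)a'=\langle a_{(2)},b\rangle a_{(1)}a',\quad (a\blacktriangleleft b)a'=\langle a_{(1)},b\rangle a_{(2)}a',\quad (a\blacktriangleright b)b'=\langle a,b_{(2)}\rangle b_{(1)}b',\quad (b\blacktriangleleft a)b'=\langle a,b_{(1)}\rangle b_{(2)}b'$$ belong to $A$, $A$, $B$, $B$ respectively, and such that the products are dual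 to the coproducts, i.e. $\langle aa',b\rangle=\langle a,a'\blacktriangleright b\rangle=\langle a',b\blacktriangleleft a\rangle$ and $\langle a,bb'\rangle=\langle b'\blacktriangleright a,b\rangle=\langle a\blacktriangleleft b,b'\rangle$. The Drinfel'd double $\mathscr D=A\bowtie B$ is the space $A\otimes B$ with product $$(a\bowtie b)(a'\bowtie b')=a\,(b_{(1)}\blacktriangleright a'\blacktriangleleft S^{-1}(b_{(3)}))\bowtie b_{(2)}b'$$ and comultiplication $\Delta(a\bowtie b)=\Delta^{cop}(a)\Delta(b)$, i.e. $(a_{(2)}\bowtie b_{(1)})\otimes(a_{(1)}\bowtie b_{(2)})$. The Heisenberg double $\mathscr H=A\# B$ is the space $A\otimes B$ with product $$(a\# b)(a'\# b')=a(b_{(1)}\blacktriangleright a')\# b_{(2)}b'.$$ Define a map $\mathscr D\otimes\mathscr H\to\mathscr H$ by $$(a\bowtie b)\cdot(a'\# b')=a_{(3)}(b_{(1)}\blacktriangleright a')S^{-1}(a_{(2)})\#(b_{(2)}b'S(b_{(3)}))\blacktriangleleft S^{-1}(a_{(1)}).$$ **Proposition 3.4.** With this action $\mathscr H$ is a left $\mathscr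 D$-module algebra. That is, $\mathscr H$ is an associative algebra with non-degenerate product, $\mathscr H$ is a unital left $\mathscr D$-module (so $(xy)\cdot h=x\cdot(y\cdot h)$ for $x,y\in\mathscr D$, $h\in\mathscr H$, and $\mathscr D\cdot\mathscr H=\mathscr H$), and for all $a\in A$, $b\in B$ and $h,k\in\mathscr H$ $$(a\bowtie b)\cdot(hk)=\big((a_{(2)}\bowtie b_{(1)})\cdot h\big)\big((a_{(1)}\bowtie b_{(2)})\cdot k\big).$$ Since $\mathscr D\cdot\mathscr H=\mathscr H$, the last identity means precisely that $x\cdot\big(h(y\cdot k)\big)=\sum (x_{(1)}\cdot h)\big((x_{(2)}y)\cdot k\big)$ for all $x,y\in\mathscr D$ and $h,k\in\mathscr H$, where $\sum x_{(1)}\otimes x_{(2)}y=\Delta(x)(1\otimes y)\in\mathscr D\otimes\mathscr D$. -/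

import Mathlib

open scoped TensorProduct

namespace MultiplierHopf

/-! ### Non-degenerate algebras and multiplier algebras

An algebra over a field `K` is a `NonUnitalRing` with a compatible `K`-module structure. -/

/-- The product of `A` is non-degenerate as a bilinear map. -/
def NondegenerateMul (A : Type*) [NonUnitalRing A] : Prop :=
  (∀ a : A, (∀ b : A, a * b = 0) → a = 0) ∧ (∀ b : A, (∀ a : A, a * b = 0) → b = 0)

section Multipliers

variable (K A : Type*) [Field K] [NonUnitalRing A] [Module K A] [IsScalarTower K A A]
  [SMulCommClass K A A]

/-- The multiplier algebra `M(A)` of a (non-degenerate) algebra `A`: a multiplier `m` is a pair of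
linear maps `x ↦ m x` (first component) and `x ↦ x m` (second component) with
`(x m) y = x (m y)`. -/
def multiplierAlgebra : Subalgebra K (Module.End K A × (Module.End K A)ᵐᵒᵖ) where
  carrier := {m | ∀ x y : A, m.2.unop x * y = x * m.1 y}
  mul_mem' := by
    intro m n hm hn x y
    have h1 := hn (m.2.unop x) y
    have h2 := hm x (n.1 y)
    simpa using h1.trans h2
  add_mem' := by
    intro m n hm hn x y
    simp [add_mul, mul_add, hm x y, hn x y]
  algebraMap_mem' := by
    intro r x y
    simp [Algebra.algebraMap_eq_smul_one, smul_mul_assoc, mul_smul_comm]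

variable {K A}

/-- The embedding of `A` in `M(A)`: an element acts by left and right multiplication. -/
def toMultiplier (a : A) : multiplierAlgebra K A :=
  ⟨(LinearMap.mulLeft K a, MulOpposite.op (LinearMap.mulRight K a)), by
    intro x y
    simp [mul_assoc]⟩

/-- The multiplier `1 ⊗ b` of `A ⊗ A`. -/
def oneTmul (b : A) : multiplierAlgebra K (A ⊗[K] A) :=
  ⟨((LinearMap.mulLeft K b).lTensor A, MulOpposite.op ((LinearMap.mulRight K b).lTensor A)), by
    intro x y
    induction x with
    | zero => simp
    | add x₁ x₂ h₁ h₂ => simp only [map_add, add_mul, h₁, h₂]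
    | tmul p q =>
      induction y with
      | zero => simp
      | add y₁ y₂ h₁ h₂ => simp only [map_add, mul_add, h₁, h₂]
      | tmul r s => simp [mul_assoc]⟩

/-- The multiplier `a ⊗ 1` of `A ⊗ A`. -/
def tmulOne (a : A) : multiplierAlgebra K (A ⊗[K] A) :=
  ⟨((LinearMap.mulLeft K a).rTensor A, MulOpposite.op ((LinearMap.mulRight K a).rTensor A)), by
    intro x y
    induction x with
    | zero => simp
    | add x₁ x₂ h₁ h₂ => simp only [map_add, add_mul, h₁, h₂]
    | tmul p q =>
      induction y with
      | zero => simp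
      | add y₁ y₂ h₁ h₂ => simp only [map_add, mul_add, h₁, h₂]
      | tmul r s => simp [mul_assoc]⟩

theorem comm_mul_comm (x y : A ⊗[K] A) :
    TensorProduct.comm K A A (x * y) = TensorProduct.comm K A A x * TensorProduct.comm K A A y := by
  induction x with
  | zero => simp
  | add x₁ x₂ h₁ h₂ => simp only [map_add, add_mul, h₁, h₂]
  | tmul p q =>
    induction y with
    | zero => simp
    | add y₁ y₂ h₁ h₂ => simp only [map_add, mul_add, h₁, h₂]
    | tmul r s => simp

/-- The flip map `τ` of `A ⊗ A`, extended to `M(A ⊗ A)`. -/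
def flipMultiplier (m : multiplierAlgebra K (A ⊗[K] A)) : multiplierAlgebra K (A ⊗[K] A) :=
  ⟨((TensorProduct.comm K A A).toLinearMap ∘ₗ m.1.1 ∘ₗ (TensorProduct.comm K A A).toLinearMap,
    MulOpposite.op ((TensorProduct.comm K A A).toLinearMap ∘ₗ m.1.2.unop ∘ₗ
      (TensorProduct.comm K A A).toLinearMap)), by
    intro x y
    have h := congrArg (TensorProduct.comm K A A)
      (m.2 (TensorProduct.comm K A A x) (TensorProduct.comm K A A y))
    have hτ : ∀ z : A ⊗[K] A, TensorProduct.comm K A A (TensorProduct.comm K A A z) = z :=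
      fun z => (TensorProduct.comm K A A).symm_apply_apply z
    rw [comm_mul_comm, comm_mul_comm, hτ, hτ] at h
    simpa using h⟩

end Multipliers

/-! ### Multiplier Hopf algebras -/

section Hopf

variable (K A : Type*) [Field K] [NonUnitalRing A] [Module K A] [IsScalarTower K A A]
  [SMulCommClass K A A]

/-- A multiplier Hopf algebra structure on the algebra `A`. The maps `T₁` and `T₂` are determined by
the comultiplication `Δ` through `T₁_spec` and `T₂_spec`, because `A ⊗ A` embeds in `M(A ⊗ A)`:
they record that `Δ(a)(1 ⊗ b)` and `(a ⊗ 1)Δ(b)` lie in `A ⊗ A` and that the two resulting linear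
maps on `A ⊗ A` are bijective. -/
structure MultiplierHopfAlgebra where
  nondegenerate : NondegenerateMul A
  /-- the comultiplication, a homomorphism of algebras -/
  Δ : A →ₙₐ[K] multiplierAlgebra K (A ⊗[K] A)
  /-- `T₁ (a ⊗ b) = Δ(a)(1 ⊗ b)`, in Sweedler notation `a₍₁₎ ⊗ a₍₂₎ b` -/
  T₁ : A ⊗[K] A ≃ₗ[K] A ⊗[K] A
  /-- `T₂ (a ⊗ b) = (a ⊗ 1)Δ(b)`, in Sweedler notation `a b₍₁₎ ⊗ b₍₂₎` -/
  T₂ : A ⊗[K] A ≃ₗ[K] A ⊗[K] A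
  T₁_spec : ∀ a b : A, toMultiplier (T₁ (a ⊗ₜ b)) = Δ a * oneTmul b
  T₂_spec : ∀ a b : A, toMultiplier (T₂ (a ⊗ₜ b)) = tmulOne a * Δ b
  /-- `(a ⊗ 1 ⊗ 1) (Δ ⊗ ι)(Δ(b)(1 ⊗ c)) = (ι ⊗ Δ)((a ⊗ 1)Δ(b)) (1 ⊗ 1 ⊗ c)` -/
  coassoc : ∀ a b c : A,
    TensorProduct.assoc K A A A
        (T₂.toLinearMap.rTensor A ((TensorProduct.assoc K A A A).symm (a ⊗ₜ T₁ (b ⊗ₜ c)))) =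
      T₁.toLinearMap.lTensor A (TensorProduct.assoc K A A A (T₂ (a ⊗ₜ b) ⊗ₜ c))

/-- A regular multiplier Hopf algebra: `(A, Δᶜᵒᵖ)` is a multiplier Hopf algebra too. In particular
`cop.T₁ (a ⊗ b) = Δᶜᵒᵖ(a)(1 ⊗ b)`, in Sweedler notation `a₍₂₎ ⊗ a₍₁₎ b`. -/
structure RegularMultiplierHopfAlgebra extends MultiplierHopfAlgebra K A where
  cop : MultiplierHopfAlgebra K A
  cop_Δ : ∀ a : A, cop.Δ a = flipMultiplier (Δ a)

variable {K A}

/-- `ε` is a counit: `(ε ⊗ ι)(Δ(a)(1 ⊗ b)) = a b` and `(ι ⊗ ε)((a ⊗ 1)Δ(b)) = a b`. -/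
def MultiplierHopfAlgebra.IsCounit (H : MultiplierHopfAlgebra K A) (ε : A →ₗ[K] K) : Prop :=
  (∀ a b : A, TensorProduct.lid K A (ε.rTensor A (H.T₁ (a ⊗ₜ b))) = a * b) ∧
  (∀ a b : A, TensorProduct.rid K A (ε.lTensor A (H.T₂ (a ⊗ₜ b))) = a * b)

/-- The counit of a multiplier Hopf algebra, the unique linear form with `IsCounit`. -/
noncomputable def MultiplierHopfAlgebra.counit (H : MultiplierHopfAlgebra K A) : A →ₗ[K] K :=
  Classical.epsilon H.IsCounit

/-- `S` is a (bijective) antipode: `m (S ⊗ ι)(Δ(a)(1 ⊗ b)) = ε(a) b` and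
`m (ι ⊗ S)((a ⊗ 1)Δ(b)) = ε(b) a`. -/
def MultiplierHopfAlgebra.IsAntipode (H : MultiplierHopfAlgebra K A) (S : A ≃ₗ[K] A) : Prop :=
  (∀ a b : A, LinearMap.mul' K A (S.toLinearMap.rTensor A (H.T₁ (a ⊗ₜ b))) = H.counit a • b) ∧
  (∀ a b : A, LinearMap.mul' K A (S.toLinearMap.lTensor A (H.T₂ (a ⊗ₜ b))) = H.counit b • a)

/-- The antipode of a regular multiplier Hopf algebra, the unique bijection `A → A` with
`IsAntipode`. -/
noncomputable def RegularMultiplierHopfAlgebra.antipode (H : RegularMultiplierHopfAlgebra K A) :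
    A ≃ₗ[K] A :=
  Classical.epsilon H.IsAntipode

/-- The adjoint map `a ⊗ x ↦ a₍₁₎ x S(a₍₂₎)`, read as `m (ι ⊗ S)` applied to `Δ(a)(x ⊗ 1)`. -/
noncomputable def RegularMultiplierHopfAlgebra.ad (H : RegularMultiplierHopfAlgebra K A) :
    A →ₗ[K] A →ₗ[K] A :=
  TensorProduct.curry (LinearMap.mul' K A ∘ₗ H.antipode.toLinearMap.lTensor A ∘ₗ
    (TensorProduct.comm K A A).toLinearMap ∘ₗ H.cop.T₁.toLinearMap)

/-- The adjoint map `a ⊗ x ↦ a₍₂₎ x S⁻¹(a₍₁₎)`, read as `m (ι ⊗ S⁻¹) τ` applied to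
`Δ(a)(1 ⊗ x)`. -/
noncomputable def RegularMultiplierHopfAlgebra.adInv (H : RegularMultiplierHopfAlgebra K A) :
    A →ₗ[K] A →ₗ[K] A :=
  TensorProduct.curry (LinearMap.mul' K A ∘ₗ H.antipode.symm.toLinearMap.lTensor A ∘ₗ
    (TensorProduct.comm K A A).toLinearMap ∘ₗ H.T₁.toLinearMap)

section Covering

variable {V : Type*} [AddCommGroup V] [Module K V]

set_option linter.unusedSectionVars false in
/-- An element of `V ⊗ A` is determined by its right multiples `t (1 ⊗ d)`. -/
theorem eq_zero_of_covered (hA : NondegenerateMul A) (t : V ⊗[K] A)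
    (ht : ∀ d : A, (LinearMap.mulRight K d).lTensor V t = 0) : t = 0 := by
  classical
  let b := Module.Basis.ofVectorSpace K V
  let e := TensorProduct.equivFinsuppOfBasisLeft (N := A) b
  apply e.injective
  rw [map_zero]
  ext i
  apply hA.1
  intro d
  have key : ∀ s : V ⊗[K] A, e ((LinearMap.mulRight K d).lTensor V s) i = e s i * d := by
    intro s
    induction s with
    | zero => simp
    | add x y hx hy => simp only [map_add, Finsupp.add_apply, hx, hy, add_mul]
    | tmul v a => simp [e, smul_mul_assoc]
  rw [← key, ht d]
  simp

theorem mul_left_nondegenerate_tensor (hA : NondegenerateMul A) (t : A ⊗[K] A)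
    (ht : ∀ y : A ⊗[K] A, t * y = 0) : t = 0 := by
  apply eq_zero_of_covered hA
  intro d
  apply (TensorProduct.comm K A A).injective
  rw [map_zero]
  apply eq_zero_of_covered hA
  intro c
  have key : ∀ s : A ⊗[K] A, (LinearMap.mulRight K c).lTensor A (TensorProduct.comm K A A
      ((LinearMap.mulRight K d).lTensor A s)) = TensorProduct.comm K A A (s * (c ⊗ₜ d)) := by
    intro s
    induction s with
    | zero => simp
    | add x y hx hy => simp only [map_add, add_mul, hx, hy]
    | tmul p q => simp
  rw [key, ht, map_zero]

/-- `(c₍₁₎ c' ⊗ c₍₂₎)(1 ⊗ d) = (c₍₁₎ ⊗ c₍₂₎ d)(c' ⊗ 1)` -/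
theorem T₁_covered_comm (H H' : MultiplierHopfAlgebra K A)
    (h : ∀ a : A, H'.Δ a = flipMultiplier (H.Δ a)) (c c' d : A) :
    (LinearMap.mulRight K d).lTensor A (TensorProduct.comm K A A (H'.T₁ (c ⊗ₜ c'))) =
      (LinearMap.mulRight K c').rTensor A (H.T₁ (c ⊗ₜ d)) := by
  rw [← sub_eq_zero]
  apply mul_left_nondegenerate_tensor H.nondegenerate
  intro y
  rw [sub_mul, sub_eq_zero]
  have hT : ∀ w : A ⊗[K] A, H.T₁ (c ⊗ₜ d) * w =
      (H.Δ c).1.1 ((LinearMap.mulLeft K d).lTensor A w) := fun w =>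
    congrArg (fun m : multiplierAlgebra K (A ⊗[K] A) => m.1.1 w) (H.T₁_spec c d)
  have hT' : ∀ w : A ⊗[K] A, H'.T₁ (c ⊗ₜ c') * w = TensorProduct.comm K A A ((H.Δ c).1.1
      (TensorProduct.comm K A A ((LinearMap.mulLeft K c').lTensor A w))) := fun w => by
    have h1 := congrArg (fun m : multiplierAlgebra K (A ⊗[K] A) => m.1.1 w) (H'.T₁_spec c c')
    rw [h] at h1
    exact h1
  have hτ : ∀ z : A ⊗[K] A, TensorProduct.comm K A A (TensorProduct.comm K A A z) = z :=
    fun z => (TensorProduct.comm K A A).symm_apply_apply z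
  have h1 : ∀ z : A ⊗[K] A, (LinearMap.mulRight K d).lTensor A z * y =
      z * (LinearMap.mulLeft K d).lTensor A y := fun z => (oneTmul (K := K) d).2 z y
  have h2 : ∀ z : A ⊗[K] A, (LinearMap.mulRight K c').rTensor A z * y =
      z * (LinearMap.mulLeft K c').rTensor A y := fun z => (tmulOne (K := K) c').2 z y
  rw [h1, h2, hT, ← hτ ((LinearMap.mulLeft K d).lTensor A y), ← comm_mul_comm, hT', hτ]
  congr 1
  clear h1 h2
  induction y with
  | zero => simp
  | add y₁ y₂ hy₁ hy₂ => simp only [map_add, hy₁, hy₂]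
  | tmul p q => simp

/-- `Φ (c ⊗ v) = c₍₁₎·v ⊗ c₍₂₎` in `V ⊗ A`, where `c·v = α c v`. In the covered Sweedler notation
this means that `Φ (c ⊗ v) (1 ⊗ d) = c₍₁₎·v ⊗ c₍₂₎ d` for all `d`, where
`c₍₁₎ ⊗ c₍₂₎ d = Δ(c)(1 ⊗ d)`. -/
def MultiplierHopfAlgebra.IsLeg (H : MultiplierHopfAlgebra K A) (α : A →ₗ[K] V →ₗ[K] V)
    (Φ : A ⊗[K] V →ₗ[K] V ⊗[K] A) : Prop :=
  ∀ (c : A) (v : V) (d : A),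
    (LinearMap.mulRight K d).lTensor V (Φ (c ⊗ₜ v)) = (α.flip v).rTensor A (H.T₁ (c ⊗ₜ d))

/-- The map `c ⊗ v ↦ c₍₁₎·v ⊗ c₍₂₎` from `A ⊗ V` to `V ⊗ A`. It exists and is unique for a unital
action of `A` on `V`, see `existsUnique_isLeg`. Used with `H.cop` it is the map
`c ⊗ v ↦ c₍₂₎·v ⊗ c₍₁₎`. -/
noncomputable def MultiplierHopfAlgebra.leg (H : MultiplierHopfAlgebra K A)
    (α : A →ₗ[K] V →ₗ[K] V) : A ⊗[K] V →ₗ[K] V ⊗[K] A :=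
  Classical.epsilon (H.IsLeg α)

/-- For a unital action of a regular multiplier Hopf algebra there is exactly one map
`c ⊗ v ↦ c₍₁₎·v ⊗ c₍₂₎`. The two structures are `(A, Δ)` and `(A, Δᶜᵒᵖ)`, in either order. -/
theorem existsUnique_isLeg (H H' : MultiplierHopfAlgebra K A)
    (h : ∀ a : A, H'.Δ a = flipMultiplier (H.Δ a)) (α : A →ₗ[K] V →ₗ[K] V)
    (hmul : ∀ (c c' : A) (v : V), α (c * c') v = α c (α c' v))
    (hunital : Function.Surjective (TensorProduct.lift α)) :
    ∃! Φ : A ⊗[K] V →ₗ[K] V ⊗[K] A, H.IsLeg α Φ := by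
  obtain ⟨σ, hσ⟩ := (TensorProduct.lift α).exists_rightInverse_of_surjective
    (LinearMap.range_eq_top.2 hunital)
  let g : A →ₗ[K] A →ₗ[K] V →ₗ[K] V ⊗[K] A :=
    (TensorProduct.curry ((TensorProduct.comm K A A).toLinearMap ∘ₗ H'.T₁.toLinearMap)).compr₂
      ((LinearMap.rTensorHom A) ∘ₗ α.flip).flip
  let Ψ : A →ₗ[K] A ⊗[K] V →ₗ[K] V ⊗[K] A :=
    TensorProduct.uncurry (RingHom.id K) A V (V ⊗[K] A) ∘ₗ g
  have hΨ : ∀ (c d : A) (w : A ⊗[K] V), (LinearMap.mulRight K d).lTensor V (Ψ c w) =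
      (α.flip (TensorProduct.lift α w)).rTensor A (H.T₁ (c ⊗ₜ d)) := by
    intro c d w
    induction w with
    | zero => simp
    | add x y hx hy => simp only [map_add, hx, hy, LinearMap.rTensor_add, LinearMap.add_apply]
    | tmul c' v =>
      have e1 : Ψ c (c' ⊗ₜ v) =
        (α.flip v).rTensor A (TensorProduct.comm K A A (H'.T₁ (c ⊗ₜ c'))) := rfl
      have e2 : α.flip (TensorProduct.lift α (c' ⊗ₜ v)) =
          α.flip v ∘ₗ LinearMap.mulRight K c' := by
        ext x
        simp [hmul]
      rw [e1, e2, LinearMap.rTensor_comp, LinearMap.comp_apply, ← T₁_covered_comm H H' h,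
        ← LinearMap.comp_apply, ← LinearMap.comp_apply, LinearMap.lTensor_comp_rTensor,
        LinearMap.rTensor_comp_lTensor]
  refine ⟨TensorProduct.lift (Ψ.compl₂ σ), ?_, ?_⟩
  · intro c v d
    have e3 : TensorProduct.lift α (σ v) = v := LinearMap.congr_fun hσ v
    have e4 := hΨ c d (σ v)
    rw [e3] at e4
    exact e4
  · intro Φ' hΦ'
    ext c v
    rw [← sub_eq_zero]
    apply eq_zero_of_covered H.nondegenerate
    intro d
    have e3 : TensorProduct.lift α (σ v) = v := LinearMap.congr_fun hσ v
    have e4 := hΨ c d (σ v)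
    rw [e3] at e4
    rw [map_sub, sub_eq_zero]
    exact (hΦ' c v d).trans e4.symm

end Covering

end Hopf

/-! ### Products and actions on `V ⊗ C` -/

section Twist

variable {K C V : Type*} [Field K] [NonUnitalRing C] [Module K C] [IsScalarTower K C C]
  [SMulCommClass K C C] [AddCommGroup V] [Module K V]

/-- For a twist `τ : C ⊗ V → V ⊗ C` and a bilinear map `m` on `C`: the operators
`v ⊗ d ↦ (ι ⊗ m(·, d)) (τ (c ⊗ v))` on `V ⊗ C`, for `c` in `C`. -/
noncomputable def twistAct (τ : C ⊗[K] V →ₗ[K] V ⊗[K] C) (m : C →ₗ[K] C →ₗ[K] C) :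
    C →ₗ[K] Module.End K (V ⊗[K] C) :=
  TensorProduct.uncurry (RingHom.id K) V C (V ⊗[K] C) ∘ₗ
    (TensorProduct.curry τ).compr₂ ((LinearMap.lTensorHom V) ∘ₗ m.flip).flip

set_option linter.unusedSectionVars false in
theorem twistAct_tmul (τ : C ⊗[K] V →ₗ[K] V ⊗[K] C) (m : C →ₗ[K] C →ₗ[K] C) (c d : C) (v : V) :
    twistAct τ m c (v ⊗ₜ d) = (m.flip d).lTensor V (τ (c ⊗ₜ v)) := rfl

/-- The operators `v ⊗ d ↦ c₍₁₎·v ⊗ c₍₂₎ d` on `V ⊗ C`, for `c` in `C`. -/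
noncomputable def smashAct (H : MultiplierHopfAlgebra K C) (α : C →ₗ[K] V →ₗ[K] V) :
    C →ₗ[K] Module.End K (V ⊗[K] C) :=
  TensorProduct.uncurry (RingHom.id K) V C (V ⊗[K] C) ∘ₗ LinearMap.lflip.toLinearMap ∘ₗ
    (TensorProduct.curry H.T₁.toLinearMap).compr₂ ((LinearMap.rTensorHom C) ∘ₗ α.flip).flip

theorem smashAct_tmul (H : MultiplierHopfAlgebra K C) (α : C →ₗ[K] V →ₗ[K] V) (c d : C) (v : V) :
    smashAct H α c (v ⊗ₜ d) = (α.flip v).rTensor C (H.T₁ (c ⊗ₜ d)) := rfl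

/-- Left multiplication of `C` on the first leg of `C ⊗ V`. -/
noncomputable def leftMulAct (K C V : Type*) [Field K] [NonUnitalRing C] [Module K C]
    [IsScalarTower K C C] [SMulCommClass K C C] [AddCommGroup V] [Module K V] :
    C →ₗ[K] Module.End K (C ⊗[K] V) :=
  (LinearMap.rTensorHom V) ∘ₗ LinearMap.mul K C

/-- For operators `f a` and `g b` on `W`, the operators `f a ∘ g b`, as a linear map on `A ⊗ B`. -/
noncomputable def composeAct {A B W : Type*} [AddCommGroup A] [Module K A] [AddCommGroup B]
    [Module K B] [AddCommGroup W] [Module K W] (f : A →ₗ[K] Module.End K W)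
    (g : B →ₗ[K] Module.End K W) : A ⊗[K] B →ₗ[K] W →ₗ[K] W :=
  TensorProduct.lift ((LinearMap.mul K (Module.End K W)).compl₁₂ f g)

theorem composeAct_tmul {A B W : Type*} [AddCommGroup A] [Module K A] [AddCommGroup B]
    [Module K B] [AddCommGroup W] [Module K W] (f : A →ₗ[K] Module.End K W)
    (g : B →ₗ[K] Module.End K W) (a : A) (b : B) (w : W) :
    composeAct f g (a ⊗ₜ b) w = f a (g b w) := rfl

end Twist

/-! ### Pairings, the Drinfel'd double and the Heisenberg double -/

section Doubles

variable {K A B : Type*} [Field K]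
  [NonUnitalRing A] [Module K A] [IsScalarTower K A A] [SMulCommClass K A A]
  [NonUnitalRing B] [Module K B] [IsScalarTower K B B] [SMulCommClass K B B]

/-- A pairing of two regular multiplier Hopf algebras: a non-degenerate bilinear form such that the
multipliers `b ▶ a`, `a ◀ b` of `A` and `a ▶ b`, `b ◀ a` of `B` given by
`(b ▶ a) a' = ⟨a₍₂₎, b⟩ a₍₁₎ a'`, `(a ◀ b) a' = ⟨a₍₁₎, b⟩ a₍₂₎ a'`,
`(a ▶ b) b' = ⟨a, b₍₂₎⟩ b₍₁₎ b'`, `(b ◀ a) b' = ⟨a, b₍₁₎⟩ b₍₂₎ b'`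
belong to `A` and `B`, respectively, and such that the products are dual to the coproducts.
The four action maps are determined by these formulas, since `A` and `B` are non-degenerate. -/
structure Pairing (HA : RegularMultiplierHopfAlgebra K A) (HB : RegularMultiplierHopfAlgebra K B)
    where
  form : A →ₗ[K] B →ₗ[K] K
  form_nondegenerate : form.Nondegenerate
  /-- `lactA b a = b ▶ a` -/
  lactA : B →ₗ[K] A →ₗ[K] A
  /-- `ractA b a = a ◀ b` -/
  ractA : B →ₗ[K] A →ₗ[K] A
  /-- `lactB a b = a ▶ b` -/
  lactB : A →ₗ[K] B →ₗ[K] B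
  /-- `ractB a b = b ◀ a` -/
  ractB : A →ₗ[K] B →ₗ[K] B
  lactA_mul : ∀ (b : B) (a a' : A),
    lactA b a * a' = TensorProduct.lid K A ((form.flip b).rTensor A (HA.cop.T₁ (a ⊗ₜ a')))
  ractA_mul : ∀ (b : B) (a a' : A),
    ractA b a * a' = TensorProduct.lid K A ((form.flip b).rTensor A (HA.T₁ (a ⊗ₜ a')))
  lactB_mul : ∀ (a : A) (b b' : B),
    lactB a b * b' = TensorProduct.lid K B ((form a).rTensor B (HB.cop.T₁ (b ⊗ₜ b')))
  ractB_mul : ∀ (a : A) (b b' : B),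
    ractB a b * b' = TensorProduct.lid K B ((form a).rTensor B (HB.T₁ (b ⊗ₜ b')))
  /-- `⟨a a', b⟩ = ⟨a, b₍₁₎⟩ ⟨a', b₍₂₎⟩`, with the second factor evaluated first -/
  form_mul_left : ∀ (a a' : A) (b : B), form (a * a') b = form a (lactB a' b)
  /-- `⟨a a', b⟩ = ⟨a, b₍₁₎⟩ ⟨a', b₍₂₎⟩`, with the first factor evaluated first -/
  form_mul_left' : ∀ (a a' : A) (b : B), form (a * a') b = form a' (ractB a b)
  /-- `⟨a, b b'⟩ = ⟨a₍₁₎, b⟩ ⟨a₍₂₎, b'⟩`, with the second factor evaluated first -/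
  form_mul_right : ∀ (a : A) (b b' : B), form a (b * b') = form (lactA b' a) b
  /-- `⟨a, b b'⟩ = ⟨a₍₁₎, b⟩ ⟨a₍₂₎, b'⟩`, with the first factor evaluated first -/
  form_mul_right' : ∀ (a : A) (b b' : B), form a (b * b') = form (ractA b a) b'

namespace Pairing

variable {HA : RegularMultiplierHopfAlgebra K A} {HB : RegularMultiplierHopfAlgebra K B}

/-- The action `b ⊗ a ↦ a ◀ S⁻¹(b)` of `B` on `A`. -/
noncomputable def ractAInv (P : Pairing HA HB) : B →ₗ[K] A →ₗ[K] A :=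
  P.ractA ∘ₗ HB.antipode.symm.toLinearMap

/-- The action `a ⊗ b ↦ b ◀ S⁻¹(a)` of `A` on `B`. -/
noncomputable def ractBInv (P : Pairing HA HB) : A →ₗ[K] B →ₗ[K] B :=
  P.ractB ∘ₗ HA.antipode.symm.toLinearMap

/-- The twist map `T (b ⊗ a) = b₍₁₎ ▶ a ◀ S⁻¹(b₍₃₎) ⊗ b₍₂₎`, obtained as the composite of
`b ⊗ a ↦ b₍₁₎ ▶ a ⊗ b₍₂₎` and `a ⊗ b ↦ a ◀ S⁻¹(b₍₂₎) ⊗ b₍₁₎`. -/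
noncomputable def twist (P : Pairing HA HB) : B ⊗[K] A →ₗ[K] A ⊗[K] B :=
  HB.cop.leg P.ractAInv ∘ₗ (TensorProduct.comm K A B).toLinearMap ∘ₗ HB.leg P.lactA

/-- Left multiplication by `b = 1 ⋈ b ∈ M(𝒟)` on `𝒟 = A ⋈ B`: `b (c ⋈ d) = T (b ⊗ c) (1 ⊗ d)`. -/
noncomputable def doubleLeftMulB (P : Pairing HA HB) : B →ₗ[K] Module.End K (A ⊗[K] B) :=
  twistAct P.twist (LinearMap.mul K B)

/-- The product of the Drinfel'd double `𝒟 = A ⋈ B`, on the space `A ⊗ B`: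
`(a ⋈ b)(a' ⋈ b') = (a ⊗ 1) T (b ⊗ a') (1 ⊗ b')`. -/
noncomputable def doubleMul (P : Pairing HA HB) : A ⊗[K] B →ₗ[K] A ⊗[K] B →ₗ[K] A ⊗[K] B :=
  composeAct (leftMulAct K A B) P.doubleLeftMulB

/-- The canonical map `x ⊗ y ↦ Δ(x)(1 ⊗ y)` of `𝒟` for the comultiplication
`Δ(a ⋈ b) = Δᶜᵒᵖ(a) Δ(b)`, that is, `(a ⋈ b) ⊗ y ↦ (a₍₂₎ ⋈ b₍₁₎) ⊗ a₍₁₎ (b₍₂₎ y)`. It is the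
composite of `b ⊗ y ↦ b₍₂₎ y ⊗ b₍₁₎` and `a ⊗ z ↦ a₍₁₎ z ⊗ a₍₂₎` with a reordering of the legs. -/
noncomputable def doubleT₁ (P : Pairing HA HB) :
    (A ⊗[K] B) ⊗[K] (A ⊗[K] B) →ₗ[K] (A ⊗[K] B) ⊗[K] (A ⊗[K] B) :=
  -- `z ⊗ a ⊗ b ↦ (a ⊗ b) ⊗ z`
  (TensorProduct.comm K (A ⊗[K] B) (A ⊗[K] B)).toLinearMap ∘ₗ
  (TensorProduct.assoc K (A ⊗[K] B) A B).toLinearMap ∘ₗ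
  -- `a ⊗ z ⊗ b₍₁₎ ↦ a₍₁₎ z ⊗ a₍₂₎ ⊗ b₍₁₎`
  (HA.leg (leftMulAct K A B)).rTensor B ∘ₗ
  (TensorProduct.assoc K A (A ⊗[K] B) B).symm.toLinearMap ∘ₗ
  -- `a ⊗ b ⊗ y ↦ a ⊗ b₍₂₎ y ⊗ b₍₁₎`
  (HB.cop.leg P.doubleLeftMulB).lTensor A ∘ₗ
  (TensorProduct.assoc K A B (A ⊗[K] B)).toLinearMap

/-- The product of the Heisenberg double `ℋ = A # B`, on the space `A ⊗ B`:
`(a # b)(a' # b') = a (b₍₁₎ ▶ a') # b₍₂₎ b'`. -/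
noncomputable def heisenbergMul (P : Pairing HA HB) : A ⊗[K] B →ₗ[K] A ⊗[K] B →ₗ[K] A ⊗[K] B :=
  composeAct (leftMulAct K A B) (smashAct HB.toMultiplierHopfAlgebra P.lactA)

/-- The operators `a' # b' ↦ b₍₁₎ ▶ a' # b₍₂₎ b' S(b₍₃₎)` on `ℋ`. -/
noncomputable def actB (P : Pairing HA HB) : B →ₗ[K] Module.End K (A ⊗[K] B) :=
  twistAct (HB.leg P.lactA) HB.ad

/-- The operators `a' # b' ↦ a₍₃₎ a' S⁻¹(a₍₂₎) # b' ◀ S⁻¹(a₍₁₎)` on `ℋ`. -/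
noncomputable def actA (P : Pairing HA HB) : A →ₗ[K] Module.End K (A ⊗[K] B) :=
  (TensorProduct.comm K B A).conj.toLinearMap ∘ₗ twistAct (HA.leg P.ractBInv) HA.adInv

/-- The action of `𝒟 = A ⋈ B` on `ℋ = A # B`: `(a ⋈ b)·(a' # b')` is
`a₍₃₎ (b₍₁₎ ▶ a') S⁻¹(a₍₂₎) # (b₍₂₎ b' S(b₍₃₎)) ◀ S⁻¹(a₍₁₎)`. -/
noncomputable def action (P : Pairing HA HB) : A ⊗[K] B →ₗ[K] A ⊗[K] B →ₗ[K] A ⊗[K] B :=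
  composeAct P.actA P.actB

end Pairing

end Doubles

/-! ### Module algebras -/

/-- `R`, with product `mulR`, is a (left) module algebra over the multiplier Hopf algebra `X`, with
product `mulX` and comultiplication given by `T₁ (x ⊗ y) = Δ(x)(1 ⊗ y)`: `R` is an associative
algebra with non-degenerate product, `R` is a unital left `X`-module, and
`x·(r s) = (x₍₁₎·r)(x₍₂₎·s)` for all `x`, `r`, `s`. Since `R` is spanned by the elements `y·s`, the
last condition is required for `y·s` in place of `s`, where it reads
`x·(r (y·s)) = (x₍₁₎·r)((x₍₂₎ y)·s)` and only the element `x₍₁₎ ⊗ x₍₂₎ y = Δ(x)(1 ⊗ y)` of `X ⊗ X`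
occurs. -/
structure IsModuleAlgebra {K X R : Type*} [Field K] [AddCommGroup X] [Module K X]
    [AddCommGroup R] [Module K R] (mulX : X →ₗ[K] X →ₗ[K] X) (T₁ : X ⊗[K] X →ₗ[K] X ⊗[K] X)
    (mulR : R →ₗ[K] R →ₗ[K] R) (act : X →ₗ[K] R →ₗ[K] R) : Prop where
  mul_assoc : ∀ r s t : R, mulR (mulR r s) t = mulR r (mulR s t)
  nondegenerate_left : ∀ r : R, (∀ s : R, mulR r s = 0) → r = 0
  nondegenerate_right : ∀ s : R, (∀ r : R, mulR r s = 0) → s = 0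
  act_mul : ∀ (x y : X) (r : R), act (mulX x y) r = act x (act y r)
  unital : Submodule.span K {r : R | ∃ (x : X) (s : R), r = act x s} = ⊤
  act_mulR : ∀ (x y : X) (r s : R),
    act x (mulR r (act y s)) =
      TensorProduct.lift (mulR.compl₁₂ (act.flip r) (act.flip s)) (T₁ (x ⊗ₜ y))

end MultiplierHopf

/-!
The Heisenberg double `ℋ = A # B` acts on `A` by the operators `π(a # b) y = a (b ▶ y)`. This
representation is faithful (`Pairing.rep_injective`) and turns the product of `ℋ` into the
composition of operators (`Pairing.rep_heisenbergMul`). Hence `ℋ` is associative, and its product is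
non-degenerate because `A A = A` and `B ▶ A = A`.

The action of the Drinfel'd double is made of two adjoint actions. In terms of operators on `A`,
they are `b·h = b₍₁₎ h S(b₍₂₎)` for `b` in `B` and `a·h = a₍₂₎ h S⁻¹(a₍₁₎)` for `a` in `A`; the
latter is the adjoint action of `(A, Δᶜᵒᵖ)`. They are characterised without
antipodes by the equations `π(b₍₁₎·h) b₍₂₎ = b π(h)` and `π(a₍₂₎·h) a₍₁₎ = a π(h)`
(`IsAdjointAction`, `Pairing.isAdjointAction_actB`, `Pairing.isAdjointAction_actA`). Because `π` is
faithful and the canonical maps are bijective, these equations determine the actions, and they imply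
that the actions are multiplicative and compatible with the product of `ℋ`
(`IsAdjointAction.mul`, `IsAdjointAction.act_mul`).

The two actions fit together to an action of the Drinfel'd double if
`b·(a·h) = (b₍₁₎ ▶ a ◀ S⁻¹(b₍₃₎))·(b₍₂₎·h)`, which is `Pairing.actB_actA`. By
`Pairing.lift_rep_spread_injective` it suffices to compare the two sides, for `a₍₂₎` and `b₍₁₎`,
on the vectors `b₍₂₎ ▶ (a₍₁₎ w)`. There the left hand side becomes `b ▶ (a π(h) w)`. On the right
hand side, `Pairing.untwist_spreadLast` removes the twist by `S⁻¹(b₍₃₎)` and the two defining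
equations give `(b₍₁₎ ▶ a) (b₍₂₎ ▶ π(h) w)`. Both agree, as `A` is a module algebra over `B`.

All Sweedler formulas have to be covered. This rests on the existence of the counit
(`exists_isCounit`) and of the bijective antipode (`exists_isAntipode`), which are constructed from
`T₁` and `T₂`; on the unitality of the actions of a pairing, which follows from the surjectivity of
`T₁` (`Pairing.lactA_surjective`); and on the fact that an element of `V ⊗ A` is determined by its
evaluations at the elements of `B` (`eq_of_sliceR`).
-/

set_option linter.unusedSectionVars false

namespace MultiplierHopf

/-! ### Separation of points and evaluation of one leg -/

section Separation

variable {K V N : Type*} [Field K] [AddCommGroup V] [Module K V] [AddCommGroup N] [Module K N]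

/-- A family of linear maps that separates the points of `N` separates, leg-wise, the points of
`V ⊗ N`. -/
theorem eq_zero_of_lTensor {ι : Type*} {W : Type*} [AddCommGroup W] [Module K W]
    (f : ι → N →ₗ[K] W) (hf : ∀ n, (∀ i, f i n = 0) → n = 0) (t : V ⊗[K] N)
    (ht : ∀ i, (f i).lTensor V t = 0) : t = 0 := by
  classical
  let b := Module.Basis.ofVectorSpace K V
  let e := TensorProduct.equivFinsuppOfBasisLeft (N := N) b
  let e' := TensorProduct.equivFinsuppOfBasisLeft (N := W) b
  apply e.injective
  rw [map_zero]
  ext j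
  apply hf
  intro i
  have key : ∀ s : V ⊗[K] N, e' ((f i).lTensor V s) j = f i (e s j) := by
    intro s
    induction s with
    | zero => simp
    | add x y hx hy => simp only [map_add, Finsupp.add_apply, hx, hy]
    | tmul v a => simp [e, e']
  rw [← key, ht i]
  simp

theorem eq_zero_of_rTensor {ι : Type*} {W : Type*} [AddCommGroup W] [Module K W]
    (f : ι → N →ₗ[K] W) (hf : ∀ n, (∀ i, f i n = 0) → n = 0) (t : N ⊗[K] V)
    (ht : ∀ i, (f i).rTensor V t = 0) : t = 0 := by
  apply (TensorProduct.comm K N V).injective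
  rw [map_zero]
  apply eq_zero_of_lTensor f hf
  intro i
  rw [← LinearMap.comm_comp_rTensor_comp_comm_eq]
  simp [ht i]

/-- Evaluation of the second leg at a linear form, `v ⊗ n ↦ φ(n) v`. -/
noncomputable def sliceR (φ : N →ₗ[K] K) : V ⊗[K] N →ₗ[K] V :=
  (TensorProduct.rid K V).toLinearMap ∘ₗ φ.lTensor V

/-- Evaluation of the first leg at a linear form, `n ⊗ v ↦ φ(n) v`. -/
noncomputable def sliceL (φ : N →ₗ[K] K) : N ⊗[K] V →ₗ[K] V :=
  (TensorProduct.lid K V).toLinearMap ∘ₗ φ.rTensor V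

@[simp] theorem sliceR_tmul (φ : N →ₗ[K] K) (v : V) (n : N) : sliceR φ (v ⊗ₜ[K] n) = φ n • v := by
  simp [sliceR]

@[simp] theorem sliceL_tmul (φ : N →ₗ[K] K) (v : V) (n : N) : sliceL φ (n ⊗ₜ[K] v) = φ n • v := by
  simp [sliceL]

theorem sliceR_comm (φ : N →ₗ[K] K) (t : N ⊗[K] V) :
    sliceR φ (TensorProduct.comm K N V t) = sliceL φ t := by
  induction t with
  | zero => simp
  | add x y hx hy => simp only [map_add, hx, hy]
  | tmul x y => simp

theorem eq_of_sliceR {ι : Type*} (f : ι → N →ₗ[K] K) (hf : ∀ n, (∀ i, f i n = 0) → n = 0)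
    {s t : V ⊗[K] N} (h : ∀ i, sliceR (f i) s = sliceR (f i) t) : s = t := by
  rw [← sub_eq_zero]
  apply eq_zero_of_lTensor f hf
  intro i
  apply (TensorProduct.rid K V).injective
  have := h i
  simp only [sliceR, LinearMap.comp_apply, LinearEquiv.coe_coe] at this
  simp [this]

theorem eq_of_sliceL {ι : Type*} (f : ι → N →ₗ[K] K) (hf : ∀ n, (∀ i, f i n = 0) → n = 0)
    {s t : N ⊗[K] V} (h : ∀ i, sliceL (f i) s = sliceL (f i) t) : s = t := by
  rw [← sub_eq_zero]
  apply eq_zero_of_rTensor f hf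
  intro i
  apply (TensorProduct.lid K V).injective
  have := h i
  simp only [sliceL, LinearMap.comp_apply, LinearEquiv.coe_coe] at this
  simp [this]

end Separation

/-! ### Non-degenerate products -/

section Algebra

variable {K A : Type*} [Field K] [NonUnitalRing A] [Module K A] [IsScalarTower K A A]
  [SMulCommClass K A A]

theorem NondegenerateMul.eq_of_mul_left {A : Type*} [NonUnitalRing A] (hA : NondegenerateMul A)
    {x y : A} (h : ∀ c, c * x = c * y) : x = y := by
  rw [← sub_eq_zero]
  exact hA.2 _ fun c => by rw [mul_sub, h, sub_self]

theorem NondegenerateMul.eq_of_mul_right {A : Type*} [NonUnitalRing A] (hA : NondegenerateMul A)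
    {x y : A} (h : ∀ c, x * c = y * c) : x = y := by
  rw [← sub_eq_zero]
  exact hA.1 _ fun c => by rw [sub_mul, h, sub_self]

variable {V : Type*} [AddCommGroup V] [Module K V]

theorem NondegenerateMul.eq_of_lTensor_mulRight (hA : NondegenerateMul A) {s t : V ⊗[K] A}
    (h : ∀ d : A, (LinearMap.mulRight K d).lTensor V s = (LinearMap.mulRight K d).lTensor V t) :
    s = t := by
  rw [← sub_eq_zero]
  exact eq_zero_of_lTensor _ hA.1 _ fun d => by rw [map_sub, h, sub_self]

theorem NondegenerateMul.eq_of_rTensor_mulLeft (hA : NondegenerateMul A) {s t : A ⊗[K] V}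
    (h : ∀ c : A, (LinearMap.mulLeft K c).rTensor V s = (LinearMap.mulLeft K c).rTensor V t) :
    s = t := by
  rw [← sub_eq_zero]
  exact eq_zero_of_rTensor _ hA.2 _ fun d => by rw [map_sub, h, sub_self]

theorem NondegenerateMul.tensor (hA : NondegenerateMul A) : NondegenerateMul (A ⊗[K] A) := by
  refine ⟨mul_left_nondegenerate_tensor hA, fun t ht => ?_⟩
  apply eq_zero_of_lTensor (fun d : A => LinearMap.mulLeft K d) hA.2
  intro d
  apply eq_zero_of_rTensor (fun c : A => LinearMap.mulLeft K c) hA.2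
  intro c
  have key : ∀ s : A ⊗[K] A, (LinearMap.mulLeft K c).rTensor A
      ((LinearMap.mulLeft K d).lTensor A s) = (c ⊗ₜ d) * s := by
    intro s
    induction s with
    | zero => simp
    | add x y hx hy => simp only [map_add, mul_add, hx, hy]
    | tmul p q => simp
  rw [key, ht]

theorem multiplier_apply_mul (hA : NondegenerateMul A) (m : multiplierAlgebra K A) (x y : A) :
    m.1.1 (x * y) = m.1.1 x * y := by
  apply hA.eq_of_mul_left
  intro z
  rw [← m.2 z, ← mul_assoc, ← mul_assoc, m.2 z x]

theorem rTensor_mulRight_mul (x : A) (s w : A ⊗[K] A) :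
    (LinearMap.mulRight K x).rTensor A s * w = s * (LinearMap.mulLeft K x).rTensor A w :=
  (tmulOne (K := K) x).2 s w

theorem lTensor_mulRight_mul (x : A) (s w : A ⊗[K] A) :
    (LinearMap.mulRight K x).lTensor A s * w = s * (LinearMap.mulLeft K x).lTensor A w :=
  (oneTmul (K := K) x).2 s w

theorem rTensor_mulLeft_mul (x : A) (s w : A ⊗[K] A) :
    (LinearMap.mulLeft K x).rTensor A (s * w) = (LinearMap.mulLeft K x).rTensor A s * w := by
  induction s with
  | zero => simp
  | add x₁ x₂ h₁ h₂ => simp only [map_add, add_mul, h₁, h₂]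
  | tmul p q =>
    induction w with
    | zero => simp
    | add y₁ y₂ h₁ h₂ => simp only [map_add, mul_add, h₁, h₂]
    | tmul r s => simp [mul_assoc]

end Algebra

namespace MultiplierHopfAlgebra

/-! ### Multiplication by the comultiplication -/

variable {K A : Type*} [Field K] [NonUnitalRing A] [Module K A] [IsScalarTower K A A]
  [SMulCommClass K A A] (H H' : MultiplierHopfAlgebra K A)

/-- Left multiplication by `Δ(a)` on `A ⊗ A`. -/
def comulLeft : A →ₗ[K] Module.End K (A ⊗[K] A) where
  toFun a := (H.Δ a).1.1
  map_add' a b := by simp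
  map_smul' r a := by simp

theorem comulLeft_mul (a b : A) (t : A ⊗[K] A) :
    H.comulLeft (a * b) t = H.comulLeft a (H.comulLeft b t) := by
  simp [comulLeft]

theorem comulLeft_apply_mul (a : A) (s t : A ⊗[K] A) :
    H.comulLeft a (s * t) = H.comulLeft a s * t :=
  multiplier_apply_mul H.nondegenerate.tensor _ _ _

theorem T₁_tmul_mul_eq (a b : A) (w : A ⊗[K] A) :
    H.T₁ (a ⊗ₜ b) * w = H.comulLeft a ((LinearMap.mulLeft K b).lTensor A w) :=
  congrArg (fun m : multiplierAlgebra K (A ⊗[K] A) => m.1.1 w) (H.T₁_spec a b)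

theorem T₂_tmul_mul_eq (a b : A) (w : A ⊗[K] A) :
    H.T₂ (a ⊗ₜ b) * w = (LinearMap.mulLeft K a).rTensor A (H.comulLeft b w) :=
  congrArg (fun m : multiplierAlgebra K (A ⊗[K] A) => m.1.1 w) (H.T₂_spec a b)

/-- `Δ(a b)(1 ⊗ c) = Δ(a) (Δ(b)(1 ⊗ c))` -/
theorem T₁_mul_tmul (a b c : A) : H.T₁ ((a * b) ⊗ₜ c) = H.comulLeft a (H.T₁ (b ⊗ₜ c)) := by
  apply H.nondegenerate.tensor.eq_of_mul_right
  intro w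
  rw [T₁_tmul_mul_eq, comulLeft_mul, ← comulLeft_apply_mul, T₁_tmul_mul_eq]

/-- `Δ(a)(x ⊗ y) = (a₍₁₎ ⊗ a₍₂₎ y)(x ⊗ 1)` -/
theorem comulLeft_tmul (a x y : A) :
    H.comulLeft a (x ⊗ₜ y) = (LinearMap.mulRight K x).rTensor A (H.T₁ (a ⊗ₜ y)) := by
  apply H.nondegenerate.tensor.eq_of_mul_right
  intro w
  rw [rTensor_mulRight_mul, T₁_tmul_mul_eq, ← comulLeft_apply_mul]
  congr 1
  induction w with
  | zero => simp
  | add y₁ y₂ h₁ h₂ => simp only [map_add, mul_add, h₁, h₂]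
  | tmul r s => simp

theorem T₁_tmul_mul (a b c : A) :
    H.T₁ (a ⊗ₜ (b * c)) = (LinearMap.mulRight K c).lTensor A (H.T₁ (a ⊗ₜ b)) := by
  apply H.nondegenerate.tensor.eq_of_mul_right
  intro w
  rw [lTensor_mulRight_mul, T₁_tmul_mul_eq, T₁_tmul_mul_eq, LinearMap.mulLeft_mul,
    LinearMap.lTensor_comp, LinearMap.comp_apply]

/-- `(c a₍₁₎ ⊗ a₍₂₎)(1 ⊗ y) = (c ⊗ 1)(a₍₁₎ ⊗ a₍₂₎ y)` -/
theorem lTensor_mulRight_T₂ (c a y : A) :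
    (LinearMap.mulRight K y).lTensor A (H.T₂ (c ⊗ₜ a)) =
      (LinearMap.mulLeft K c).rTensor A (H.T₁ (a ⊗ₜ y)) := by
  apply H.nondegenerate.tensor.eq_of_mul_right
  intro w
  rw [lTensor_mulRight_mul, T₂_tmul_mul_eq, ← rTensor_mulLeft_mul, T₁_tmul_mul_eq]

variable {H H'}

/-- `(c a₍₁₎ ⊗ a₍₂₎)(x ⊗ 1) = (c ⊗ 1)(a₍₁₎ x ⊗ a₍₂₎)` -/
theorem rTensor_mulRight_T₂ (h : ∀ a : A, H'.Δ a = flipMultiplier (H.Δ a)) (c a x : A) :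
    (LinearMap.mulRight K x).rTensor A (H.T₂ (c ⊗ₜ a)) =
      (LinearMap.mulLeft K c).rTensor A (TensorProduct.comm K A A (H'.T₁ (a ⊗ₜ x))) := by
  apply H.nondegenerate.eq_of_lTensor_mulRight
  intro d
  rw [← LinearMap.comp_apply, ← LinearMap.comp_apply, LinearMap.lTensor_comp_rTensor,
    LinearMap.lTensor_comp_rTensor, ← LinearMap.rTensor_comp_lTensor,
    ← LinearMap.rTensor_comp_lTensor, LinearMap.comp_apply, LinearMap.comp_apply,
    lTensor_mulRight_T₂, T₁_covered_comm H H' h, ← LinearMap.comp_apply, ← LinearMap.comp_apply,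
    ← LinearMap.rTensor_comp, ← LinearMap.rTensor_comp]
  congr 2
  ext z
  simp [mul_assoc]

/-- `(A, Δ)` is the co-opposite of `(A, Δᶜᵒᵖ)`. -/
theorem flip_symm (h : ∀ a : A, H'.Δ a = flipMultiplier (H.Δ a)) (a : A) :
    H.Δ a = flipMultiplier (H'.Δ a) := by
  rw [h]
  apply Subtype.ext
  refine Prod.ext ?_ (MulOpposite.unop_injective ?_) <;>
  · refine LinearMap.ext fun x => ?_
    simp [flipMultiplier]

end MultiplierHopfAlgebra

namespace MultiplierHopfAlgebra

variable {K A : Type*} [Field K] [NonUnitalRing A] [Module K A] [IsScalarTower K A A]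
  [SMulCommClass K A A] (H H' : MultiplierHopfAlgebra K A)

/-! ### The counit -/

/-- Coassociativity on all of `A ⊗ (A ⊗ A)`. -/
theorem coassoc_apply (w : A ⊗[K] (A ⊗[K] A)) :
    TensorProduct.assoc K A A A (H.T₂.toLinearMap.rTensor A ((TensorProduct.assoc K A A A).symm
      (H.T₁.toLinearMap.lTensor A w))) =
    H.T₁.toLinearMap.lTensor A (TensorProduct.assoc K A A A (H.T₂.toLinearMap.rTensor A
      ((TensorProduct.assoc K A A A).symm w))) := by
  induction w with
  | zero => simp
  | add x y hx hy => simp only [map_add, hx, hy]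
  | tmul a t =>
    induction t with
    | zero => simp
    | add x y hx hy => simp only [map_add, TensorProduct.tmul_add, hx, hy]
    | tmul b c => simpa using H.coassoc a b c

/-- `m T₁⁻¹ (y ⊗ c)` and `m T₂⁻¹ (x ⊗ y)` are multiples of `c` and of `x`, by the same scalar: this
scalar is the counit of `y`. -/
theorem tmul_mul_symm_eq (x y c : A) :
    x ⊗ₜ[K] LinearMap.mul' K A (H.T₁.symm (y ⊗ₜ c)) =
      LinearMap.mul' K A (H.T₂.symm (x ⊗ₜ y)) ⊗ₜ[K] c := by
  have h1 : ∀ (a : A) (w : A ⊗[K] A),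
      (LinearMap.mul' K A ∘ₗ H.T₁.symm.toLinearMap).lTensor A (TensorProduct.assoc K A A A
        (H.T₂.toLinearMap.rTensor A ((TensorProduct.assoc K A A A).symm (a ⊗ₜ H.T₁ w)))) =
      (LinearMap.mulLeft K a).rTensor A (H.T₁ w) := by
    intro a w
    have h2 := H.coassoc_apply (a ⊗ₜ w)
    rw [LinearMap.lTensor_tmul, LinearEquiv.coe_coe] at h2
    rw [h2]
    clear h2
    induction w with
    | zero => simp
    | add x y hx hy => simp only [map_add, TensorProduct.tmul_add, hx, hy]
    | tmul p q =>
      rw [← lTensor_mulRight_T₂, ← LinearMap.comp_apply, ← LinearMap.lTensor_comp]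
      have h3 : (LinearMap.mul' K A ∘ₗ H.T₁.symm.toLinearMap) ∘ₗ H.T₁.toLinearMap =
        LinearMap.mul' K A := by ext; simp
      rw [h3, TensorProduct.assoc_symm_tmul, LinearMap.rTensor_tmul, LinearEquiv.coe_coe]
      generalize H.T₂ (a ⊗ₜ p) = s
      induction s with
      | zero => simp
      | add x y hx hy => simp only [map_add, TensorProduct.add_tmul, hx, hy]
      | tmul f g => simp
  have h4 : ∀ t : A ⊗[K] A, (LinearMap.mul' K A ∘ₗ H.T₁.symm.toLinearMap).lTensor A
      (TensorProduct.assoc K A A A (H.T₂ t ⊗ₜ c)) = LinearMap.mul' K A t ⊗ₜ[K] c := by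
    intro t
    induction t with
    | zero => simp
    | add x y hx hy => simp only [map_add, TensorProduct.add_tmul, hx, hy]
    | tmul a b =>
      have h5 := h1 a (H.T₁.symm (b ⊗ₜ c))
      rw [LinearEquiv.apply_symm_apply] at h5
      simpa using h5
  have h6 := h4 (H.T₂.symm (x ⊗ₜ y))
  rw [LinearEquiv.apply_symm_apply] at h6
  simpa using h6

/-- The counit is read off from `tmul_mul_symm_eq`: `m T₁⁻¹ = ε ⊗ ι` and `m T₂⁻¹ = ι ⊗ ε`. -/
theorem exists_isCounit : ∃ ε, H.IsCounit ε := by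
  by_cases hA : ∀ x : A, x = 0
  · exact ⟨0, fun a b => (hA _).trans (hA _).symm, fun a b => (hA _).trans (hA _).symm⟩
  push Not at hA
  obtain ⟨x, hx⟩ := hA
  obtain ⟨f, hf⟩ := Module.Projective.exists_dual_ne_zero K hx
  let ε : A →ₗ[K] K := (f x)⁻¹ • (f ∘ₗ LinearMap.mul' K A ∘ₗ H.T₂.symm.toLinearMap ∘ₗ
    TensorProduct.mk K A A x)
  have hε : ∀ y c, LinearMap.mul' K A (H.T₁.symm (y ⊗ₜ c)) = ε y • c := by
    intro y c
    have h1 := congrArg (sliceL f) (H.tmul_mul_symm_eq x y c)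
    simp only [sliceL_tmul] at h1
    simp [ε, mul_smul, ← h1, hf]
  have hε' : ∀ z y, LinearMap.mul' K A (H.T₂.symm (z ⊗ₜ y)) = ε y • z := by
    intro z y
    have h1 := congrArg (sliceR f) (H.tmul_mul_symm_eq z y x)
    rw [hε] at h1
    simp only [sliceR_tmul, map_smul, smul_eq_mul] at h1
    rw [mul_comm, mul_smul] at h1
    exact (smul_right_injective A hf h1).symm
  refine ⟨ε, fun a b => ?_, fun a b => ?_⟩
  · have h2 : LinearMap.mul' K A ∘ₗ H.T₁.symm.toLinearMap =
        (TensorProduct.lid K A).toLinearMap ∘ₗ ε.rTensor A := by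
      ext y c
      simp [hε]
    simpa using (LinearMap.congr_fun h2 (H.T₁ (a ⊗ₜ b))).symm
  · have h2 : LinearMap.mul' K A ∘ₗ H.T₂.symm.toLinearMap =
        (TensorProduct.rid K A).toLinearMap ∘ₗ ε.lTensor A := by
      ext y c
      simp [hε']
    simpa using (LinearMap.congr_fun h2 (H.T₂ (a ⊗ₜ b))).symm

theorem isCounit_counit : H.IsCounit H.counit := Classical.epsilon_spec H.exists_isCounit

theorem sliceL_counit_T₁ (t : A ⊗[K] A) : sliceL H.counit (H.T₁ t) = LinearMap.mul' K A t := by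
  induction t with
  | zero => simp
  | add x y hx hy => simp only [map_add, hx, hy]
  | tmul a b => exact H.isCounit_counit.1 a b

theorem sliceR_counit_T₂ (t : A ⊗[K] A) : sliceR H.counit (H.T₂ t) = LinearMap.mul' K A t := by
  induction t with
  | zero => simp
  | add x y hx hy => simp only [map_add, hx, hy]
  | tmul a b => exact H.isCounit_counit.2 a b

variable {H} in
/-- Uniqueness of the counit; its first defining property suffices. -/
theorem eq_of_sliceL_T₁ {φ : A →ₗ[K] K} (h : ∀ a b, sliceL φ (H.T₁ (a ⊗ₜ b)) = a * b) :
    φ = H.counit := by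
  have h1 : ∀ t : A ⊗[K] A, sliceL φ t = sliceL H.counit t := by
    intro t
    obtain ⟨t, rfl⟩ := H.T₁.surjective t
    rw [sliceL_counit_T₁]
    induction t with
    | zero => simp
    | add x y hx hy => simp only [map_add, hx, hy]
    | tmul a b => simpa using h a b
  ext x
  have h2 := h1 (x ⊗ₜ x)
  simp only [sliceL_tmul] at h2
  by_cases hx : x = 0
  · simp [hx]
  · exact smul_left_injective K hx h2

/-- The span of the products is the whole algebra. -/
theorem mul'_surjective (H : MultiplierHopfAlgebra K A) :
    Function.Surjective (LinearMap.mul' K A) := by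
  intro x
  -- If the counit vanishes, then so does the product, and `A = 0` by non-degeneracy.
  by_cases hA : H.counit = 0
  · have h0 : ∀ a b : A, a * b = 0 := by
      intro a b
      have := H.sliceL_counit_T₁ (a ⊗ₜ b)
      simpa [hA, sliceL] using this.symm
    exact ⟨0, by rw [map_zero, H.nondegenerate.1 x (h0 x)]⟩
  · obtain ⟨a, ha⟩ : ∃ a, H.counit a ≠ 0 := by
      by_contra! h
      exact hA (LinearMap.ext h)
    refine ⟨H.T₁.symm ((H.counit a)⁻¹ • a ⊗ₜ x), ?_⟩
    rw [← sliceL_counit_T₁, LinearEquiv.apply_symm_apply]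
    simp [ha, smul_smul]

theorem counit_mul (a b : A) : H.counit (a * b) = H.counit a * H.counit b := by
  have h1 : ∀ a t, sliceL H.counit (H.comulLeft a t) = a * sliceL H.counit t := by
    intro a t
    obtain ⟨t, rfl⟩ := H.T₁.surjective t
    induction t with
    | zero => simp
    | add x y hx hy => simp only [map_add, mul_add, hx, hy]
    | tmul b d => rw [← T₁_mul_tmul, sliceL_counit_T₁, sliceL_counit_T₁]; simp [mul_assoc]
  have h2 : ∀ x t, sliceL H.counit ((LinearMap.mulRight K x).rTensor A t) =
      H.counit x • sliceL H.counit t := by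
    intro x t
    obtain ⟨t, rfl⟩ := H.T₁.surjective t
    induction t with
    | zero => simp
    | add x y hx hy => simp only [map_add, smul_add, hx, hy]
    | tmul a y =>
      rw [← comulLeft_tmul, h1, sliceL_counit_T₁]
      simp [mul_smul_comm]
  have h3 := h2 b (a ⊗ₜ a)
  simp only [LinearMap.rTensor_tmul, LinearMap.mulRight_apply, sliceL_tmul, smul_smul] at h3
  by_cases ha : a = 0
  · simp [ha]
  · rw [smul_left_injective K ha h3, mul_comm]

variable {H H'}

/-- `ε(a₍₂₎) a₍₁₎ b = a b` -/
theorem sliceL_counit_T₁_cop (h : ∀ a : A, H'.Δ a = flipMultiplier (H.Δ a)) (a b : A) :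
    sliceL H.counit (H'.T₁ (a ⊗ₜ b)) = a * b := by
  apply H.nondegenerate.eq_of_mul_left
  intro c
  have h1 : ∀ t : A ⊗[K] A, c * sliceL H.counit t =
      sliceR H.counit ((LinearMap.mulLeft K c).rTensor A (TensorProduct.comm K A A t)) := by
    intro t
    induction t with
    | zero => simp
    | add x y hx hy => simp only [map_add, mul_add, hx, hy]
    | tmul a y => simp [mul_smul_comm]
  have h2 : ∀ t : A ⊗[K] A, sliceR H.counit ((LinearMap.mulRight K b).rTensor A t) =
      sliceR H.counit t * b := by
    intro t
    induction t with
    | zero => simp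
    | add x y hx hy => simp only [map_add, add_mul, hx, hy]
    | tmul a y => simp [smul_mul_assoc]
  rw [h1, ← rTensor_mulRight_T₂ h, h2, sliceR_counit_T₂]
  simp [mul_assoc]

/-- The counit of `(A, Δᶜᵒᵖ)` is that of `(A, Δ)`. -/
theorem counit_cop (h : ∀ a : A, H'.Δ a = flipMultiplier (H.Δ a)) : H'.counit = H.counit :=
  (eq_of_sliceL_T₁ (sliceL_counit_T₁_cop h)).symm

end MultiplierHopfAlgebra

namespace MultiplierHopfAlgebra

variable {K A : Type*} [Field K] [NonUnitalRing A] [Module K A] [IsScalarTower K A A]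
  [SMulCommClass K A A] (H H' : MultiplierHopfAlgebra K A)

/-! ### The antipode -/

/-- `a ⊗ b ↦ S(a) b`, the left multiplication by the antipode, as `(ε ⊗ ι) T₁⁻¹`. -/
noncomputable def antipodeMul : A ⊗[K] A →ₗ[K] A := sliceL H.counit ∘ₗ H.T₁.symm.toLinearMap

/-- `a ⊗ b ↦ a S(b)`, the right multiplication by the antipode, as `(ι ⊗ ε) T₂⁻¹`. -/
noncomputable def mulAntipode : A ⊗[K] A →ₗ[K] A := sliceR H.counit ∘ₗ H.T₂.symm.toLinearMap

theorem antipodeMul_T₁ (t : A ⊗[K] A) : H.antipodeMul (H.T₁ t) = sliceL H.counit t := by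
  simp [antipodeMul]

theorem mulAntipode_T₂ (t : A ⊗[K] A) : H.mulAntipode (H.T₂ t) = sliceR H.counit t := by
  simp [mulAntipode]

theorem exists_counit_eq_one (H : MultiplierHopfAlgebra K A) {x : A} (hx : x ≠ 0) :
    ∃ p, H.counit p = 1 := by
  by_contra! h
  have h0 : ∀ p, H.counit p = 0 := by
    intro p
    by_contra hp
    exact h ((H.counit p)⁻¹ • p) (by simp [hp])
  apply hx
  apply H.nondegenerate.1
  intro b
  have := H.sliceL_counit_T₁ (x ⊗ₜ b)
  rw [show H.counit = 0 from LinearMap.ext h0] at this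
  simpa [sliceL] using this.symm

theorem antipodeMul_surjective : Function.Surjective H.antipodeMul := by
  intro x
  by_cases hx : x = 0
  · exact ⟨0, by simp [hx]⟩
  obtain ⟨p, hp⟩ := H.exists_counit_eq_one hx
  exact ⟨H.T₁ (p ⊗ₜ x), by rw [antipodeMul_T₁]; simp [hp]⟩

theorem mulAntipode_surjective : Function.Surjective H.mulAntipode := by
  intro x
  by_cases hx : x = 0
  · exact ⟨0, by simp [hx]⟩
  obtain ⟨p, hp⟩ := H.exists_counit_eq_one hx
  exact ⟨H.T₂ (x ⊗ₜ p), by rw [mulAntipode_T₂]; simp [hp]⟩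

/-- `(a S(b)) c = a (S(b) c)` -/
theorem mulAntipode_mul (a b c : A) :
    H.mulAntipode (a ⊗ₜ b) * c = a * H.antipodeMul (b ⊗ₜ c) := by
  -- The two sides are values of linear maps on `A ⊗ (A ⊗ A)` which agree after composition with
  -- the bijection `(T₂ ⊗ ι)(ι ⊗ T₁) = (ι ⊗ T₁)(T₂ ⊗ ι)`: both become `a ⊗ b ⊗ c ↦ a b c`.
  let f : A ⊗[K] (A ⊗[K] A) →ₗ[K] A := LinearMap.mul' K A ∘ₗ H.mulAntipode.rTensor A ∘ₗ
    (TensorProduct.assoc K A A A).symm.toLinearMap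
  let g : A ⊗[K] (A ⊗[K] A) →ₗ[K] A := LinearMap.mul' K A ∘ₗ H.antipodeMul.lTensor A
  let X : A ⊗[K] (A ⊗[K] A) ≃ₗ[K] A ⊗[K] (A ⊗[K] A) := (H.T₁.lTensor A) ≪≫ₗ
    (TensorProduct.assoc K A A A).symm ≪≫ₗ (H.T₂.rTensor A) ≪≫ₗ TensorProduct.assoc K A A A
  have hX : ∀ w, X w = H.T₁.toLinearMap.lTensor A (TensorProduct.assoc K A A A
      (H.T₂.toLinearMap.rTensor A ((TensorProduct.assoc K A A A).symm w))) :=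
    fun w => H.coassoc_apply w
  have hf : ∀ a b c : A, f (X (a ⊗ₜ (b ⊗ₜ c))) = a * b * c := by
    intro a b c
    have h1 : ∀ t : A ⊗[K] A, f (X (a ⊗ₜ t)) = a * sliceL H.counit (H.T₁ t) := by
      intro t
      simp only [f, X, LinearMap.comp_apply, LinearEquiv.coe_coe, LinearEquiv.trans_apply,
        LinearEquiv.symm_apply_apply, LinearEquiv.lTensor_tmul]
      generalize H.T₁ t = s
      induction s with
      | zero => simp
      | add x y hx hy => simp only [map_add, TensorProduct.tmul_add, mul_add, hx, hy]
      | tmul p q => simp [mulAntipode_T₂, smul_mul_assoc, mul_smul_comm]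
    rw [h1, sliceL_counit_T₁]
    simp [mul_assoc]
  have hg : ∀ a b c : A, g (X (a ⊗ₜ (b ⊗ₜ c))) = a * b * c := by
    intro a b c
    have h1 : ∀ t : A ⊗[K] A, g (H.T₁.toLinearMap.lTensor A
        (TensorProduct.assoc K A A A (t ⊗ₜ c))) = sliceR H.counit t * c := by
      intro t
      induction t with
      | zero => simp
      | add x y hx hy => simp only [map_add, TensorProduct.add_tmul, add_mul, hx, hy]
      | tmul p q => simp [g, antipodeMul_T₁, smul_mul_assoc]
    rw [hX, TensorProduct.assoc_symm_tmul, LinearMap.rTensor_tmul, h1, LinearEquiv.coe_coe,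
      sliceR_counit_T₂]
    simp
  have hfg : f ∘ₗ X.toLinearMap = g ∘ₗ X.toLinearMap := by
    ext a b c
    simp [hf, hg]
  have h2 := LinearMap.congr_fun hfg (X.symm (a ⊗ₜ (b ⊗ₜ c)))
  simpa [f, g] using h2

/-- `S(a x) b = S(x) (S(a) b)` -/
theorem antipodeMul_mul_tmul (a x b : A) :
    H.antipodeMul ((a * x) ⊗ₜ b) = H.antipodeMul (x ⊗ₜ H.antipodeMul (a ⊗ₜ b)) := by
  have h1 : ∀ a t, H.antipodeMul (H.comulLeft a t) = H.counit a • H.antipodeMul t := by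
    intro a t
    obtain ⟨t, rfl⟩ := H.T₁.surjective t
    induction t with
    | zero => simp
    | add x y hx hy => simp only [map_add, smul_add, hx, hy]
    | tmul b d =>
      rw [← T₁_mul_tmul, antipodeMul_T₁, antipodeMul_T₁]
      simp [counit_mul, mul_smul]
  have h2 : ∀ t : A ⊗[K] A, H.antipodeMul ((LinearMap.mulRight K x).rTensor A t) =
      H.antipodeMul (x ⊗ₜ H.antipodeMul t) := by
    intro t
    obtain ⟨t, rfl⟩ := H.T₁.surjective t
    induction t with
    | zero => simp
    | add x y hx hy => simp only [map_add, TensorProduct.tmul_add, hx, hy]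
    | tmul a y =>
      rw [← comulLeft_tmul, h1, antipodeMul_T₁]
      simp
  simpa using h2 (a ⊗ₜ b)

/-- `a S(b x) = (a S(x)) S(b)` -/
theorem mulAntipode_tmul_mul (a b x : A) :
    H.mulAntipode (a ⊗ₜ (b * x)) = H.mulAntipode (H.mulAntipode (a ⊗ₜ x) ⊗ₜ b) := by
  apply H.nondegenerate.eq_of_mul_right
  intro d
  rw [mulAntipode_mul, mulAntipode_mul, mulAntipode_mul, antipodeMul_mul_tmul]

variable {H H'}

/-- `c S(S'(b) a) = (c S(a)) b` for the antipode `S'` of `(A, Δᶜᵒᵖ)`, whence the elements `S(x)` of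
`M(A)` belong to `A`. -/
theorem mulAntipode_antipodeMul_cop (h : ∀ a : A, H'.Δ a = flipMultiplier (H.Δ a)) (a b c : A) :
    H.mulAntipode (c ⊗ₜ H'.antipodeMul (b ⊗ₜ a)) = H.mulAntipode (c ⊗ₜ a) * b := by
  have h1 : ∀ t : A ⊗[K] A, H.mulAntipode (c ⊗ₜ H'.antipodeMul t) = LinearMap.mul' K A
      ((H.mulAntipode ∘ₗ TensorProduct.mk K A A c).rTensor A (TensorProduct.comm K A A t)) := by
    intro t
    obtain ⟨t, rfl⟩ := H'.T₁.surjective t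
    induction t with
    | zero => simp
    | add x y hx hy => simp only [map_add, TensorProduct.tmul_add, hx, hy]
    | tmul p q =>
      apply H.nondegenerate.eq_of_mul_right
      intro d
      have h2 : ∀ s : A ⊗[K] A, LinearMap.mul' K A
          ((H.mulAntipode ∘ₗ TensorProduct.mk K A A c).rTensor A s) * d =
          LinearMap.mul' K A ((H.mulAntipode ∘ₗ TensorProduct.mk K A A c).rTensor A
            ((LinearMap.mulRight K d).lTensor A s)) := by
        intro s
        induction s with
        | zero => simp
        | add x y hx hy => simp only [map_add, add_mul, hx, hy]
        | tmul p q => simp [mul_assoc]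
      have h3 : ∀ s : A ⊗[K] A, LinearMap.mul' K A
          ((H.mulAntipode ∘ₗ TensorProduct.mk K A A c).rTensor A
            ((LinearMap.mulRight K q).rTensor A s)) =
          H.mulAntipode (c ⊗ₜ q) * H.antipodeMul s := by
        intro s
        induction s with
        | zero => simp
        | add x y hx hy => simp only [map_add, mul_add, hx, hy]
        | tmul u v =>
          simp [mulAntipode_tmul_mul, mulAntipode_mul]
      rw [h2, T₁_covered_comm H H' h, h3, antipodeMul_T₁, antipodeMul_T₁, counit_cop h]
      simp [smul_mul_assoc, mul_smul_comm]
  simpa using h1 (b ⊗ₜ a)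

/-- The antipode as a linear map into `A`. By `mulAntipode_antipodeMul_cop` the multiplier `S(x)` is
the element `S(a) b` of `A` if `x = S'(b) a`, and such elements span `A`. -/
theorem exists_antipode_map (h : ∀ a : A, H'.Δ a = flipMultiplier (H.Δ a)) :
    ∃ S : A →ₗ[K] A, (∀ x d, S x * d = H.antipodeMul (x ⊗ₜ d)) ∧
      (∀ c x, c * S x = H.mulAntipode (c ⊗ₜ x)) ∧
      ∀ a b, S (H'.antipodeMul (b ⊗ₜ a)) = S a * b := by
  obtain ⟨σ, hσ⟩ := H'.antipodeMul.exists_rightInverse_of_surjective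
    (LinearMap.range_eq_top.2 H'.antipodeMul_surjective)
  let S : A →ₗ[K] A := H.antipodeMul ∘ₗ (TensorProduct.comm K A A).toLinearMap ∘ₗ σ
  have h1 : ∀ c x, c * S x = H.mulAntipode (c ⊗ₜ x) := by
    intro c x
    have h2 : ∀ t : A ⊗[K] A, c * H.antipodeMul (TensorProduct.comm K A A t) =
        H.mulAntipode (c ⊗ₜ H'.antipodeMul t) := by
      intro t
      induction t with
      | zero => simp
      | add x y hx hy => simp only [map_add, mul_add, TensorProduct.tmul_add, hx, hy]
      | tmul b a => rw [TensorProduct.comm_tmul, ← mulAntipode_mul, mulAntipode_antipodeMul_cop h]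
    have h3 : H'.antipodeMul (σ x) = x := LinearMap.congr_fun hσ x
    have h4 := h2 (σ x)
    rwa [h3] at h4
  refine ⟨S, fun x d => ?_, h1, fun a b => ?_⟩
  · apply H.nondegenerate.eq_of_mul_left
    intro c
    rw [← mul_assoc, h1, mulAntipode_mul]
  · apply H.nondegenerate.eq_of_mul_left
    intro c
    rw [h1, mulAntipode_antipodeMul_cop h, ← mul_assoc, h1]

/-- The antipodes of `(A, Δ)` and `(A, Δᶜᵒᵖ)` are inverse to each other:
`S(a) S(S'(b)) = S(S'(b) a) = S(a) b`. -/
theorem antipode_map_comp {S S' : A →ₗ[K] A}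
    (hS : ∀ x d, S x * d = H.antipodeMul (x ⊗ₜ d)) (hS₁ : ∀ c x, c * S x = H.mulAntipode (c ⊗ₜ x))
    (hS₂ : ∀ a b, S (H'.antipodeMul (b ⊗ₜ a)) = S a * b)
    (hS' : ∀ x d, S' x * d = H'.antipodeMul (x ⊗ₜ d)) (b : A) : S (S' b) = b := by
  have hanti : ∀ u x, S (u * x) = S x * S u := by
    intro u x
    apply H.nondegenerate.eq_of_mul_right
    intro d
    rw [mul_assoc, hS, hS, hS, antipodeMul_mul_tmul]
  rw [← sub_eq_zero]
  apply H.nondegenerate.2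
  intro c
  obtain ⟨t, rfl⟩ := H.mulAntipode_surjective c
  induction t with
  | zero => simp
  | add x y hx hy => rw [map_add, add_mul, hx, hy, add_zero]
  | tmul c a =>
    rw [← hS₁, mul_assoc, mul_sub, ← hanti, hS', hS₂, sub_self, mul_zero]

end MultiplierHopfAlgebra

namespace RegularMultiplierHopfAlgebra

open MultiplierHopfAlgebra

variable {K A : Type*} [Field K] [NonUnitalRing A] [Module K A] [IsScalarTower K A A]
  [SMulCommClass K A A] (H : RegularMultiplierHopfAlgebra K A)

theorem exists_isAntipode : ∃ S : A ≃ₗ[K] A, H.IsAntipode S := by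
  have h' := flip_symm H.cop_Δ
  obtain ⟨S, h1, h2, h3⟩ := exists_antipode_map H.cop_Δ
  obtain ⟨S', h1', h2', h3'⟩ := exists_antipode_map h'
  refine ⟨LinearEquiv.ofLinearMap S S' (LinearMap.ext (antipode_map_comp h1 h2 h3 h1'))
    (LinearMap.ext (antipode_map_comp h1' h2' h3' h1)), fun a b => ?_, fun a b => ?_⟩
  · have h4 : LinearMap.mul' K A ∘ₗ S.rTensor A = H.antipodeMul := by
      ext x d
      simp [h1]
    have h5 := LinearMap.congr_fun h4 (H.T₁ (a ⊗ₜ b))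
    rw [antipodeMul_T₁, sliceL_tmul] at h5
    exact h5
  · have h4 : LinearMap.mul' K A ∘ₗ S.lTensor A = H.mulAntipode := by
      ext x d
      simp [h2]
    have h5 := LinearMap.congr_fun h4 (H.T₂ (a ⊗ₜ b))
    rw [mulAntipode_T₂, sliceR_tmul] at h5
    exact h5

theorem isAntipode_antipode : H.IsAntipode H.antipode := Classical.epsilon_spec H.exists_isAntipode

/-- `S(a₍₁₎) a₍₂₎ b = ε(a) b` -/
theorem antipode_T₁ (a b : A) : LinearMap.mul' K A (H.antipode.toLinearMap.rTensor A
    (H.T₁ (a ⊗ₜ b))) = H.counit a • b := H.isAntipode_antipode.1 a b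

/-- `a b₍₁₎ S(b₍₂₎) = ε(b) a` -/
theorem antipode_T₂ (a b : A) : LinearMap.mul' K A (H.antipode.toLinearMap.lTensor A
    (H.T₂ (a ⊗ₜ b))) = H.counit b • a := H.isAntipode_antipode.2 a b

theorem antipode_mul_eq (a b : A) : H.antipode a * b = H.antipodeMul (a ⊗ₜ b) := by
  have h1 : ∀ t : A ⊗[K] A, LinearMap.mul' K A (H.antipode.toLinearMap.rTensor A t) =
      H.antipodeMul t := by
    intro t
    obtain ⟨t, rfl⟩ := H.T₁.surjective t
    induction t with
    | zero => simp
    | add x y hx hy => simp only [map_add, hx, hy]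
    | tmul a b => rw [antipode_T₁, antipodeMul_T₁, sliceL_tmul]
  simpa using h1 (a ⊗ₜ b)

theorem antipode_mul (a b : A) : H.antipode (a * b) = H.antipode b * H.antipode a := by
  apply H.nondegenerate.eq_of_mul_right
  intro d
  rw [mul_assoc, antipode_mul_eq, antipode_mul_eq, antipode_mul_eq, antipodeMul_mul_tmul]

theorem antipode_symm_mul (a b : A) :
    H.antipode.symm (a * b) = H.antipode.symm b * H.antipode.symm a := by
  apply H.antipode.injective
  simp [antipode_mul]

/-- `S⁻¹(a₍₂₎) a₍₁₎ b = ε(a) b`: the inverse of `S` is the antipode of `(A, Δᶜᵒᵖ)`. -/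
theorem antipode_symm_cop_T₁ (a b : A) : LinearMap.mul' K A (H.antipode.symm.toLinearMap.rTensor A
    (H.cop.T₁ (a ⊗ₜ b))) = H.counit a • b := by
  apply H.antipode.injective
  apply H.nondegenerate.eq_of_mul_right
  intro d
  have h1 : ∀ t : A ⊗[K] A, H.antipode (LinearMap.mul' K A
      (H.antipode.symm.toLinearMap.rTensor A t)) * d = LinearMap.mul' K A
      (H.antipode.toLinearMap.rTensor A
        ((LinearMap.mulRight K d).lTensor A (TensorProduct.comm K A A t))) := by
    intro t
    induction t with
    | zero => simp
    | add x y hx hy => simp only [map_add, add_mul, hx, hy]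
    | tmul p q => simp [antipode_mul, mul_assoc]
  have h2 : ∀ t : A ⊗[K] A, LinearMap.mul' K A (H.antipode.toLinearMap.rTensor A
      ((LinearMap.mulRight K b).rTensor A t)) =
      H.antipode b * LinearMap.mul' K A (H.antipode.toLinearMap.rTensor A t) := by
    intro t
    induction t with
    | zero => simp
    | add x y hx hy => simp only [map_add, mul_add, hx, hy]
    | tmul p q => simp [antipode_mul, mul_assoc]
  rw [h1, T₁_covered_comm _ _ H.cop_Δ, h2, antipode_T₁]
  simp [smul_mul_assoc, mul_smul_comm]

end RegularMultiplierHopfAlgebra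

namespace MultiplierHopfAlgebra

variable {K A : Type*} [Field K] [NonUnitalRing A] [Module K A] [IsScalarTower K A A]
  [SMulCommClass K A A] {H H' : MultiplierHopfAlgebra K A}

/-! ### The adjoint map and the pentagon equation -/

/-- `(a₍₁₎ x S(a₍₂₎)) a₍₃₎ d = a x d`. The hypothesis on `S` also holds for the inverse of the
antipode and `(A, Δᶜᵒᵖ)`, so that the statement applies to both adjoint maps. -/
theorem adjoint_T₁ (h : ∀ a : A, H'.Δ a = flipMultiplier (H.Δ a)) {S : A →ₗ[K] A}
    (hS : ∀ a b, LinearMap.mul' K A (S.rTensor A (H.T₁ (a ⊗ₜ b))) = H.counit a • b)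
    {ad : A →ₗ[K] A →ₗ[K] A}
    (had : ∀ a x, ad a x = LinearMap.mul' K A (S.lTensor A
      (TensorProduct.comm K A A (H'.T₁ (a ⊗ₜ x))))) (b x d : A) :
    LinearMap.mul' K A ((ad.flip x).rTensor A (H.T₁ (b ⊗ₜ d))) = b * x * d := by
  apply H.nondegenerate.eq_of_mul_left
  intro c
  -- `f ⊗ g ⊗ q ↦ f x S(g) q`
  let F : A ⊗[K] (A ⊗[K] A) →ₗ[K] A := LinearMap.mul' K A ∘ₗ
    (LinearMap.mulRight K x).rTensor A ∘ₗ (LinearMap.mul' K A ∘ₗ S.rTensor A).lTensor A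
  have h1 : ∀ s : A ⊗[K] A, c * LinearMap.mul' K A ((ad.flip x).rTensor A s) =
      F (TensorProduct.assoc K A A A (H.T₂.toLinearMap.rTensor A
        ((TensorProduct.assoc K A A A).symm (c ⊗ₜ s)))) := by
    intro s
    induction s with
    | zero => simp
    | add x y hx hy => simp only [map_add, TensorProduct.tmul_add, mul_add, hx, hy]
    | tmul p q =>
      have h2 : c * ad p x = LinearMap.mul' K A (S.lTensor A
          ((LinearMap.mulRight K x).rTensor A (H.T₂ (c ⊗ₜ p)))) := by
        rw [rTensor_mulRight_T₂ h, had]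
        generalize TensorProduct.comm K A A (H'.T₁ (p ⊗ₜ x)) = s
        induction s with
        | zero => simp
        | add x y hx hy => simp only [map_add, mul_add, hx, hy]
        | tmul p q => simp [mul_assoc]
      rw [LinearMap.rTensor_tmul, LinearMap.mul'_apply, LinearMap.flip_apply, ← mul_assoc, h2,
        TensorProduct.assoc_symm_tmul, LinearMap.rTensor_tmul, LinearEquiv.coe_coe]
      generalize H.T₂ (c ⊗ₜ p) = s
      induction s with
      | zero => simp
      | add x y hx hy => simp only [map_add, add_mul, TensorProduct.add_tmul, hx, hy]
      | tmul f g => simp [F, mul_assoc]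
  have h3 : ∀ s : A ⊗[K] A, F (H.T₁.toLinearMap.lTensor A
      (TensorProduct.assoc K A A A (s ⊗ₜ d))) = sliceR H.counit s * x * d := by
    intro s
    induction s with
    | zero => simp
    | add x y hx hy => simp only [map_add, add_mul, TensorProduct.add_tmul, hx, hy]
    | tmul f g => simp [F, hS, smul_mul_assoc]
  have h4 := H.coassoc_apply (c ⊗ₜ (b ⊗ₜ d))
  rw [LinearMap.lTensor_tmul, LinearEquiv.coe_coe] at h4
  rw [h1, h4, TensorProduct.assoc_symm_tmul, LinearMap.rTensor_tmul, LinearEquiv.coe_coe, h3,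
    sliceR_counit_T₂]
  simp [mul_assoc]

variable (H) in
/-- The map `d ⊗ c ↦ b₍₁₎ ⊗ b₍₂₎ d ⊗ b₍₃₎ c`, read as `(Δ ⊗ ι)(Δ(b)(1 ⊗ c)) (1 ⊗ d ⊗ 1)`. -/
noncomputable def T₁Twice (b : A) : A ⊗[K] A →ₗ[K] A ⊗[K] (A ⊗[K] A) :=
  (TensorProduct.assoc K A A A).toLinearMap ∘ₗ H.T₁.toLinearMap.rTensor A ∘ₗ
  (TensorProduct.assoc K A A A).symm.toLinearMap ∘ₗ
  (TensorProduct.comm K A A).toLinearMap.lTensor A ∘ₗ (TensorProduct.assoc K A A A).toLinearMap ∘ₗ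
  (H.T₁.toLinearMap ∘ₗ TensorProduct.mk K A A b).rTensor A ∘ₗ (TensorProduct.comm K A A).toLinearMap

variable (H) in
theorem T₁Twice_tmul (b d c : A) : H.T₁Twice b (d ⊗ₜ c) = TensorProduct.assoc K A A A
    ((H.T₁.toLinearMap ∘ₗ (TensorProduct.mk K A A).flip d).rTensor A (H.T₁ (b ⊗ₜ c))) := by
  have h1 : ∀ s : A ⊗[K] A, H.T₁.toLinearMap.rTensor A ((TensorProduct.assoc K A A A).symm
      ((TensorProduct.comm K A A).toLinearMap.lTensor A (TensorProduct.assoc K A A A (s ⊗ₜ d)))) =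
      (H.T₁.toLinearMap ∘ₗ (TensorProduct.mk K A A).flip d).rTensor A s := by
    intro s
    induction s with
    | zero => simp
    | add x y hx hy => simp only [map_add, TensorProduct.add_tmul, hx, hy]
    | tmul f g => simp
  simp [T₁Twice, ← h1]

variable (H) in
/-- The pentagon equation for `T₁`. -/
theorem T₁Twice_T₁ (b d c : A) : H.T₁Twice b (H.T₁ (d ⊗ₜ c)) =
    H.T₁.toLinearMap.lTensor A (TensorProduct.assoc K A A A (H.T₁ (b ⊗ₜ d) ⊗ₜ c)) := by
  apply H.nondegenerate.eq_of_rTensor_mulLeft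
  intro e
  have h1 : ∀ t : A ⊗[K] A, (LinearMap.mulLeft K e).rTensor _ (H.T₁Twice b t) =
      (H.comulLeft.flip t).lTensor A (H.T₂ (e ⊗ₜ b)) := by
    intro t
    induction t with
    | zero => simp
    | add x y hx hy => simp only [map_add, LinearMap.lTensor_add, LinearMap.add_apply, hx, hy]
    | tmul d c =>
      have h2 : ∀ s : A ⊗[K] A, (LinearMap.mulLeft K e).rTensor _ (TensorProduct.assoc K A A A
          ((H.T₁.toLinearMap ∘ₗ (TensorProduct.mk K A A).flip d).rTensor A s)) =
          ((LinearMap.mulRight K d).rTensor A).lTensor A (TensorProduct.assoc K A A A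
            (H.T₂.toLinearMap.rTensor A ((TensorProduct.assoc K A A A).symm (e ⊗ₜ s)))) := by
        intro s
        induction s with
        | zero => simp
        | add x y hx hy => simp only [map_add, TensorProduct.tmul_add, hx, hy]
        | tmul p q =>
          have h3 : ∀ s : A ⊗[K] A, (LinearMap.mulLeft K e).rTensor _
              (TensorProduct.assoc K A A A (s ⊗ₜ q)) =
              TensorProduct.assoc K A A A ((LinearMap.mulLeft K e).rTensor A s ⊗ₜ q) := by
            intro s
            induction s with
            | zero => simp
            | add x y hx hy => simp only [map_add, TensorProduct.add_tmul, hx, hy]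
            | tmul f g => simp
          have h4 : ∀ s : A ⊗[K] A, TensorProduct.assoc K A A A
              ((LinearMap.mulRight K d).lTensor A s ⊗ₜ q) =
              ((LinearMap.mulRight K d).rTensor A).lTensor A
                (TensorProduct.assoc K A A A (s ⊗ₜ q)) := by
            intro s
            induction s with
            | zero => simp
            | add x y hx hy => simp only [map_add, TensorProduct.add_tmul, hx, hy]
            | tmul f g => simp
          simp [h3, ← h4, lTensor_mulRight_T₂]
      have h5 := H.coassoc_apply (e ⊗ₜ (b ⊗ₜ c))
      rw [LinearMap.lTensor_tmul, LinearEquiv.coe_coe] at h5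
      rw [T₁Twice_tmul, h2, h5, TensorProduct.assoc_symm_tmul, LinearMap.rTensor_tmul,
        LinearEquiv.coe_coe]
      generalize H.T₂ (e ⊗ₜ b) = s
      induction s with
      | zero => simp
      | add x y hx hy => simp only [map_add, TensorProduct.add_tmul, hx, hy]
      | tmul f g => simp [comulLeft_tmul]
  have h6 : ∀ s : A ⊗[K] A, (LinearMap.mulLeft K e).rTensor _ (H.T₁.toLinearMap.lTensor A
      (TensorProduct.assoc K A A A (s ⊗ₜ c))) = H.T₁.toLinearMap.lTensor A
      (TensorProduct.assoc K A A A ((LinearMap.mulLeft K e).rTensor A s ⊗ₜ c)) := by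
    intro s
    induction s with
    | zero => simp
    | add x y hx hy => simp only [map_add, TensorProduct.add_tmul, hx, hy]
    | tmul f g => simp
  rw [h1, h6, ← lTensor_mulRight_T₂]
  generalize H.T₂ (e ⊗ₜ b) = s
  induction s with
  | zero => simp
  | add x y hx hy => simp only [map_add, TensorProduct.add_tmul, hx, hy]
  | tmul f g => simp [T₁_mul_tmul]

/-! ### Adjoint actions -/

section AdjointAction

variable {M Z : Type*} [AddCommGroup M] [Module K M] [AddCommGroup Z] [Module K Z]

/-- For actions `γ` of `A` on `M` and `l` on `Z` and a map `π : M → End(Z)`, the linear map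
`p ⊗ q ↦ π(p·h) (q z)`. -/
noncomputable def intertwine (π : M →ₗ[K] Module.End K Z) (γ : A →ₗ[K] Module.End K M)
    (l : A →ₗ[K] Module.End K Z) (h : M) (z : Z) : A ⊗[K] A →ₗ[K] Z :=
  TensorProduct.lift (π.compl₁₂ (γ.flip h) (l.flip z))

@[simp] theorem intertwine_tmul (π : M →ₗ[K] Module.End K Z) (γ : A →ₗ[K] Module.End K M)
    (l : A →ₗ[K] Module.End K Z) (h : M) (z : Z) (p q : A) :
    intertwine π γ l h z (p ⊗ₜ q) = π (γ p h) (l q z) := rfl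

variable (H) in
/-- `γ` is the adjoint action of `A` on `M`, when `M` and `A` act on `Z` through `π` and `l`:
`a₍₁₎·h = a₍₁₎ h S(a₍₂₎)` as operators on `Z`, which is to say `π(a₍₁₎·h) a₍₂₎ = a π(h)`. -/
def IsAdjointAction (π : M →ₗ[K] Module.End K Z) (γ : A →ₗ[K] Module.End K M)
    (l : A →ₗ[K] Module.End K Z) : Prop :=
  ∀ (h : M) (z : Z) (b d : A),
    intertwine π γ l h z (H.T₁ (b ⊗ₜ d)) = l b (π h (l d z))

variable {π : M →ₗ[K] Module.End K Z} {γ : A →ₗ[K] Module.End K M} {l : A →ₗ[K] Module.End K Z}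

/-- Linear maps `f` from `A` to `M` are determined by the elements `π(f(a₍₁₎)) a₍₂₎ d z`. -/
theorem ext_of_T₁ (hπ : Function.Injective π)
    (hl : Function.Surjective (TensorProduct.lift l)) {f g : A →ₗ[K] M}
    (hfg : ∀ (z : Z) (b d : A), TensorProduct.lift (π.compl₁₂ f (l.flip z)) (H.T₁ (b ⊗ₜ d)) =
      TensorProduct.lift (π.compl₁₂ g (l.flip z)) (H.T₁ (b ⊗ₜ d))) : f = g := by
  ext a
  apply hπ
  ext w
  obtain ⟨t, rfl⟩ := hl w
  induction t with
  | zero => simp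
  | add x y hx hy => simp only [map_add, hx, hy]
  | tmul d z =>
    have h1 : ∀ t : A ⊗[K] A, TensorProduct.lift (π.compl₁₂ f (l.flip z)) t =
      TensorProduct.lift (π.compl₁₂ g (l.flip z)) t := by
      intro t
      obtain ⟨t, rfl⟩ := H.T₁.surjective t
      induction t with
      | zero => simp
      | add x y hx hy => simp only [map_add, hx, hy]
      | tmul b d => exact hfg z b d
    simpa using h1 (a ⊗ₜ d)

/-- An adjoint action is multiplicative: `π((a₍₁₎ b)·h) a₍₂₎ = π(a₍₁₎·(b·h)) a₍₂₎` after covering by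
the elements of `A`. -/
theorem IsAdjointAction.mul (hγ : H.IsAdjointAction π γ l) (hπ : Function.Injective π)
    (hl : Function.Surjective (TensorProduct.lift l)) (hlmul : ∀ a b z, l (a * b) z = l a (l b z))
    (a b : A) (h : M) : γ (a * b) h = γ a (γ b h) := by
  have key : ∀ u : A, γ.flip h ∘ₗ LinearMap.mulRight K u = γ.flip (γ u h) := by
    intro u
    apply ext_of_T₁ (H := H) hπ hl
    intro z a v
    have h1 : ∀ t : A ⊗[K] A, intertwine π γ l h z (H.comulLeft a t) =
        l a (intertwine π γ l h z t) := by
      intro t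
      obtain ⟨t, rfl⟩ := H.T₁.surjective t
      induction t with
      | zero => simp
      | add x y hx hy => simp only [map_add, hx, hy]
      | tmul b d => rw [← T₁_mul_tmul, hγ, hγ, hlmul]
    have h2 := h1 (u ⊗ₜ v)
    rw [comulLeft_tmul, intertwine_tmul, ← hγ] at h2
    refine Eq.trans ?_ h2
    generalize H.T₁ (a ⊗ₜ v) = s
    induction s with
    | zero => simp
    | add x y hx hy => simp only [map_add, hx, hy]
    | tmul f g => simp
  exact LinearMap.congr_fun (key b) a

/-- `b·(h (d·k)) = (b₍₁₎·h) ((b₍₂₎ d)·k)`, since both sides have the same image under `π` after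
multiplication by one more leg of `b`. -/
theorem IsAdjointAction.act_mul (hγ : H.IsAdjointAction π γ l) (hπ : Function.Injective π)
    (hl : Function.Surjective (TensorProduct.lift l))
    {m : M →ₗ[K] M →ₗ[K] M} (hm : ∀ h k, π (m h k) = π h * π k) (b d : A) (h k : M) :
    γ b (m h (γ d k)) =
      TensorProduct.lift (m.compl₁₂ (γ.flip h) (γ.flip k)) (H.T₁ (b ⊗ₜ d)) := by
  let mm : A ⊗[K] A →ₗ[K] M := TensorProduct.lift (m.compl₁₂ (γ.flip h) (γ.flip k))
  have key : γ.flip (m h (γ d k)) = mm ∘ₗ H.T₁.toLinearMap ∘ₗ (TensorProduct.mk K A A).flip d := by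
    apply ext_of_T₁ (H := H) hπ hl
    intro z b c
    let Ξ : A ⊗[K] (A ⊗[K] A) →ₗ[K] Z :=
      TensorProduct.lift (π.compl₁₂ (γ.flip h) (intertwine π γ l k z))
    have h1 : ∀ t, Ξ (H.T₁Twice b t) = l b (π h (intertwine π γ l k z t)) := by
      intro t
      obtain ⟨t, rfl⟩ := H.T₁.surjective t
      induction t with
      | zero => simp
      | add x y hx hy => simp only [map_add, hx, hy]
      | tmul d c =>
        rw [T₁Twice_T₁, hγ, ← hγ]
        generalize H.T₁ (b ⊗ₜ d) = s
        induction s with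
        | zero => simp
        | add x y hx hy => simp only [map_add, TensorProduct.add_tmul, hx, hy]
        | tmul f g => simp [Ξ, hγ k z g c]
    have h2 := h1 (d ⊗ₜ c)
    rw [T₁Twice_tmul, intertwine_tmul] at h2
    have h3 := hγ (m h (γ d k)) z b c
    rw [hm, Module.End.mul_apply, ← h2] at h3
    refine Eq.trans h3 ?_
    generalize H.T₁ (b ⊗ₜ c) = s
    induction s with
    | zero => simp
    | add x y hx hy => simp only [map_add, hx, hy]
    | tmul p q =>
      simp only [LinearMap.rTensor_tmul, TensorProduct.lift.tmul, LinearMap.compl₁₂_apply,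
        LinearMap.comp_apply, LinearMap.flip_apply, TensorProduct.mk_apply, LinearEquiv.coe_coe]
      generalize H.T₁ (p ⊗ₜ d) = s
      induction s with
      | zero => simp
      | add x y hx hy => simp only [map_add, TensorProduct.add_tmul, LinearMap.add_apply, hx, hy]
      | tmul f g => simp [Ξ, mm, hm]
  exact LinearMap.congr_fun key b

end AdjointAction

end MultiplierHopfAlgebra

/-! ### Unital actions and their legs -/

/-- A linear map `α : A → End(V)` is a unital action if it is multiplicative and `A·V = V`. -/
structure IsUnitalAction {K A V : Type*} [Field K] [NonUnitalRing A] [Module K A]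
    [AddCommGroup V] [Module K V] (α : A →ₗ[K] V →ₗ[K] V) : Prop where
  mul : ∀ (a b : A) (v : V), α (a * b) v = α a (α b v)
  surjective : Function.Surjective (TensorProduct.lift α)

section Leg

variable {K A V : Type*} [Field K] [NonUnitalRing A] [Module K A] [IsScalarTower K A A]
  [SMulCommClass K A A] [AddCommGroup V] [Module K V]

/-- Linear statements about a module with a unital action need only be checked on the elements
`a·v`. -/
theorem IsUnitalAction.ext {α : A →ₗ[K] V →ₗ[K] V} (hα : IsUnitalAction α) {W : Type*}
    [AddCommGroup W] [Module K W] {f g : V →ₗ[K] W} (h : ∀ a v, f (α a v) = g (α a v)) :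
    f = g := by
  ext w
  obtain ⟨t, rfl⟩ := hα.surjective w
  induction t with
  | zero => simp
  | add x y hx hy => simp only [map_add, hx, hy]
  | tmul a v => simpa using h a v

theorem isUnitalAction_mul (H : MultiplierHopfAlgebra K A) :
    IsUnitalAction (LinearMap.mul K A) :=
  ⟨fun a b v => mul_assoc a b v, H.mul'_surjective⟩

theorem isUnitalAction_leftMulAct (H : MultiplierHopfAlgebra K A) :
    IsUnitalAction (leftMulAct K A V) := by
  refine ⟨fun a b v => ?_, fun w => ?_⟩
  · have h1 : LinearMap.mul K A (a * b) = LinearMap.mul K A a ∘ₗ LinearMap.mul K A b := by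
      ext
      simp [mul_assoc]
    simp [leftMulAct, h1, LinearMap.rTensor_comp]
  · induction w with
    | zero => exact ⟨0, by simp⟩
    | add x y hx hy =>
      obtain ⟨s, rfl⟩ := hx
      obtain ⟨t, rfl⟩ := hy
      exact ⟨s + t, by simp⟩
    | tmul a v =>
      obtain ⟨t, rfl⟩ := H.mul'_surjective a
      induction t with
      | zero => exact ⟨0, by simp⟩
      | add x y hx hy =>
        obtain ⟨s, hs⟩ := hx
        obtain ⟨t, ht⟩ := hy
        exact ⟨s + t, by simp [hs, ht, TensorProduct.add_tmul]⟩
      | tmul a b => exact ⟨a ⊗ₜ (b ⊗ₜ v), by simp [leftMulAct]⟩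

namespace MultiplierHopfAlgebra

variable {H H' : MultiplierHopfAlgebra K A} {α : A →ₗ[K] V →ₗ[K] V}

theorem isLeg_leg (h : ∀ a : A, H'.Δ a = flipMultiplier (H.Δ a)) (hα : IsUnitalAction α) :
    H.IsLeg α (H.leg α) :=
  Classical.epsilon_spec (existsUnique_isLeg H H' h α hα.mul hα.surjective).exists

/-- `c₍₁₎·(e·v) ⊗ c₍₂₎ = (c₍₁₎ e)·v ⊗ c₍₂₎` -/
theorem leg_tmul_act (h : ∀ a : A, H'.Δ a = flipMultiplier (H.Δ a)) (hα : IsUnitalAction α)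
    (c e : A) (v : V) : H.leg α (c ⊗ₜ α e v) =
      (α.flip v).rTensor A (TensorProduct.comm K A A (H'.T₁ (c ⊗ₜ e))) := by
  apply H.nondegenerate.eq_of_lTensor_mulRight
  intro d
  rw [isLeg_leg h hα, ← LinearMap.comp_apply (LinearMap.lTensor _ _),
    LinearMap.lTensor_comp_rTensor, ← LinearMap.rTensor_comp_lTensor, LinearMap.comp_apply,
    T₁_covered_comm H H' h, ← LinearMap.rTensor_comp_apply]
  congr 2
  ext x
  simp [hα.mul]

theorem leg_surjective (h : ∀ a : A, H'.Δ a = flipMultiplier (H.Δ a)) (hα : IsUnitalAction α) :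
    Function.Surjective (H.leg α) := by
  rw [← LinearMap.range_eq_top, eq_top_iff, ← TensorProduct.span_tmul_eq_top, Submodule.span_le]
  rintro _ ⟨w, a, rfl⟩
  obtain ⟨t, rfl⟩ := hα.surjective w
  induction t with
  | zero => simp
  | add x y hx hy =>
    rw [map_add, TensorProduct.add_tmul]
    exact add_mem hx hy
  | tmul e v =>
    have h1 : ∀ t : A ⊗[K] A, (α.flip v).rTensor A (TensorProduct.comm K A A t) ∈
        LinearMap.range (H.leg α) := by
      intro t
      obtain ⟨t, rfl⟩ := H'.T₁.surjective t
      induction t with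
      | zero => simp
      | add x y hx hy =>
        rw [map_add, map_add, map_add]
        exact add_mem hx hy
      | tmul c e => exact ⟨_, leg_tmul_act h hα c e v⟩
    simpa using h1 (a ⊗ₜ e)

end MultiplierHopfAlgebra

end Leg

namespace Pairing

/-! ### Pairings -/

open MultiplierHopfAlgebra

variable {K A B : Type*} [Field K]
  [NonUnitalRing A] [Module K A] [IsScalarTower K A A] [SMulCommClass K A A]
  [NonUnitalRing B] [Module K B] [IsScalarTower K B B] [SMulCommClass K B B]
  {HA : RegularMultiplierHopfAlgebra K A} {HB : RegularMultiplierHopfAlgebra K B}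

/-- The pairing with the two multiplier Hopf algebras exchanged. -/
def swap (P : Pairing HA HB) : Pairing HB HA where
  form := P.form.flip
  form_nondegenerate := ⟨P.form_nondegenerate.2, P.form_nondegenerate.1⟩
  lactA := P.lactB
  ractA := P.ractB
  lactB := P.lactA
  ractB := P.ractA
  lactA_mul := P.lactB_mul
  ractA_mul := P.ractB_mul
  lactB_mul := P.lactA_mul
  ractB_mul := P.ractA_mul
  form_mul_left b b' a := P.form_mul_right a b b'
  form_mul_left' b b' a := P.form_mul_right' a b b'
  form_mul_right b a a' := P.form_mul_left a a' b
  form_mul_right' b a a' := P.form_mul_left' a a' b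

variable (P : Pairing HA HB)

theorem eq_zero_of_form_flip (a : A) (h : ∀ b, P.form.flip b a = 0) : a = 0 :=
  P.form_nondegenerate.1 a h

theorem eq_zero_of_form (b : B) (h : ∀ a, P.form a b = 0) : b = 0 :=
  P.form_nondegenerate.2 b h

theorem ext_left {a a' : A} (h : ∀ b, P.form a b = P.form a' b) : a = a' := by
  rw [← sub_eq_zero]
  exact P.eq_zero_of_form_flip _ fun b => by simp [h]

theorem lactA_mul_left (b b' : B) (a : A) : P.lactA (b * b') a = P.lactA b (P.lactA b' a) := by
  apply P.ext_left
  intro x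
  simp only [← P.form_mul_right, mul_assoc]

theorem ractA_mul_left (b b' : B) (a : A) : P.ractA (b * b') a = P.ractA b' (P.ractA b a) := by
  apply P.ext_left
  intro x
  simp only [← P.form_mul_right', mul_assoc]

theorem lactA_ractA (b b' : B) (a : A) :
    P.lactA b (P.ractA b' a) = P.ractA b' (P.lactA b a) := by
  apply P.ext_left
  intro x
  simp only [← P.form_mul_right, ← P.form_mul_right', mul_assoc]

theorem form_sliceR (b b' : B) (t : A ⊗[K] A) :
    P.form (sliceR (P.form.flip b) t) b' = P.form (sliceL (P.form.flip b') t) b := by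
  induction t with
  | zero => simp
  | add x y hx hy => simp only [map_add, LinearMap.add_apply, hx, hy]
  | tmul p q => simp [mul_comm]

/-! ### Evaluations of one leg of the canonical maps -/

theorem sliceL_T₁ (b : B) (a x : A) :
    sliceL (P.form.flip b) (HA.T₁ (a ⊗ₜ x)) = P.ractA b a * x := (P.ractA_mul b a x).symm

theorem sliceL_cop_T₁ (b : B) (a x : A) :
    sliceL (P.form.flip b) (HA.cop.T₁ (a ⊗ₜ x)) = P.lactA b a * x := (P.lactA_mul b a x).symm

theorem sliceR_T₁ (b : B) (a x : A) :
    sliceR (P.form.flip b) (HA.T₁ (a ⊗ₜ x)) = P.lactA (P.lactB x b) a := by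
  apply P.ext_left
  intro b'
  rw [form_sliceR, sliceL_T₁, form_mul_left, ← form_mul_right', ← form_mul_right]

theorem sliceR_cop_T₁ (b : B) (a x : A) :
    sliceR (P.form.flip b) (HA.cop.T₁ (a ⊗ₜ x)) = P.ractA (P.lactB x b) a := by
  apply P.ext_left
  intro b'
  rw [form_sliceR, sliceL_cop_T₁, form_mul_left, ← form_mul_right', ← form_mul_right]

theorem sliceR_T₂ (b : B) (c a : A) :
    sliceR (P.form.flip b) (HA.T₂ (c ⊗ₜ a)) = c * P.lactA b a := by
  apply HA.nondegenerate.eq_of_mul_right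
  intro x
  have h1 : ∀ t : A ⊗[K] A, sliceR (P.form.flip b) t * x =
      sliceR (P.form.flip b) ((LinearMap.mulRight K x).rTensor A t) := by
    intro t
    induction t with
    | zero => simp
    | add x y hx hy => simp only [map_add, add_mul, hx, hy]
    | tmul p q => simp [smul_mul_assoc]
  have h2 : ∀ t : A ⊗[K] A, sliceR (P.form.flip b) ((LinearMap.mulLeft K c).rTensor A
      (TensorProduct.comm K A A t)) = c * sliceL (P.form.flip b) t := by
    intro t
    induction t with
    | zero => simp
    | add x y hx hy => simp only [map_add, mul_add, hx, hy]
    | tmul p q => simp [mul_smul_comm]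
  rw [h1, rTensor_mulRight_T₂ HA.cop_Δ, h2, sliceL_cop_T₁, mul_assoc]

theorem sliceL_T₂ (b : B) (c a : A) :
    sliceL (P.form.flip b) (HA.T₂ (c ⊗ₜ a)) = P.ractA (P.ractB c b) a := by
  apply HA.nondegenerate.eq_of_mul_right
  intro x
  have h1 : ∀ t : A ⊗[K] A, sliceL (P.form.flip b) t * x =
      sliceL (P.form.flip b) ((LinearMap.mulRight K x).lTensor A t) := by
    intro t
    induction t with
    | zero => simp
    | add x y hx hy => simp only [map_add, add_mul, hx, hy]
    | tmul p q => simp [smul_mul_assoc]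
  have h2 : ∀ t : A ⊗[K] A, sliceL (P.form.flip b) ((LinearMap.mulLeft K c).rTensor A t) =
      sliceL (P.form.flip (P.ractB c b)) t := by
    intro t
    induction t with
    | zero => simp
    | add x y hx hy => simp only [map_add, hx, hy]
    | tmul p q => simp [P.form_mul_left']
  rw [h1, lTensor_mulRight_T₂, h2, sliceL_T₁]

/-! ### Unitality of the actions of a pairing -/

/-- `(y ▶ b') ▶ a` is the evaluation of `Δ(a)(1 ⊗ y)` at `b'` in the second leg, and `T₁` is
surjective. -/
theorem lactA_surjective : Function.Surjective (TensorProduct.lift P.lactA) := by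
  intro x
  by_cases hx : x = 0
  · exact ⟨0, by simp [hx]⟩
  obtain ⟨b, hb⟩ : ∃ b, P.form x b ≠ 0 := by
    by_contra! h
    exact hx (P.eq_zero_of_form_flip x h)
  have h1 : ∀ t : A ⊗[K] A, ∃ s, TensorProduct.lift P.lactA s = sliceR (P.form.flip b) t := by
    intro t
    obtain ⟨t, rfl⟩ := HA.T₁.surjective t
    induction t with
    | zero => exact ⟨0, by simp⟩
    | add x y hx hy =>
      obtain ⟨s, hs⟩ := hx
      obtain ⟨t, ht⟩ := hy
      exact ⟨s + t, by simp [hs, ht]⟩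
    | tmul a y => exact ⟨P.lactB y b ⊗ₜ a, by simp [sliceR_T₁]⟩
  obtain ⟨s, hs⟩ := h1 (x ⊗ₜ ((P.form x b)⁻¹ • x))
  exact ⟨s, by simpa [hb] using hs⟩

theorem ractA_surjective : Function.Surjective (TensorProduct.lift P.ractA) := by
  intro x
  by_cases hx : x = 0
  · exact ⟨0, by simp [hx]⟩
  obtain ⟨b, hb⟩ : ∃ b, P.form x b ≠ 0 := by
    by_contra! h
    exact hx (P.eq_zero_of_form_flip x h)
  have h1 : ∀ t : A ⊗[K] A, ∃ s, TensorProduct.lift P.ractA s = sliceR (P.form.flip b) t := by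
    intro t
    obtain ⟨t, rfl⟩ := HA.cop.T₁.surjective t
    induction t with
    | zero => exact ⟨0, by simp⟩
    | add x y hx hy =>
      obtain ⟨s, hs⟩ := hx
      obtain ⟨t, ht⟩ := hy
      exact ⟨s + t, by simp [hs, ht]⟩
    | tmul a y => exact ⟨P.lactB y b ⊗ₜ a, by simp [sliceR_cop_T₁]⟩
  obtain ⟨s, hs⟩ := h1 (x ⊗ₜ ((P.form x b)⁻¹ • x))
  exact ⟨s, by simpa [hb] using hs⟩

theorem isUnitalAction_lactA : IsUnitalAction P.lactA := ⟨P.lactA_mul_left, P.lactA_surjective⟩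

theorem isUnitalAction_ractAInv : IsUnitalAction P.ractAInv := by
  refine ⟨fun b b' a => ?_, fun x => ?_⟩
  · simp [ractAInv, HB.antipode_symm_mul, ractA_mul_left]
  · obtain ⟨t, rfl⟩ := P.ractA_surjective x
    refine ⟨HB.antipode.toLinearMap.rTensor A t, ?_⟩
    rw [← LinearMap.comp_apply]
    congr 1
    ext b a
    simp [ractAInv]

theorem isUnitalAction_ractBInv : IsUnitalAction P.ractBInv := P.swap.isUnitalAction_ractAInv

section Leg

variable {V : Type*} [AddCommGroup V] [Module K V] {α : A →ₗ[K] V →ₗ[K] V}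

theorem sliceR_lTensor_mulRight (b : B) (d : A) (t : V ⊗[K] A) :
    sliceR (P.form.flip b) ((LinearMap.mulRight K d).lTensor V t) =
      sliceR (P.form.flip (P.lactB d b)) t := by
  induction t with
  | zero => simp
  | add x y hx hy => simp only [map_add, hx, hy]
  | tmul p q => simp [P.form_mul_left]

theorem sliceR_rTensor_flip (b : B) (v : V) (t : A ⊗[K] A) :
    sliceR (P.form.flip b) ((α.flip v).rTensor A t) = α (sliceR (P.form.flip b) t) v := by
  induction t with
  | zero => simp
  | add x y hx hy => simp only [map_add, LinearMap.add_apply, hx, hy]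
  | tmul p q => simp

/-- `⟨a₍₂₎, b⟩ a₍₁₎·v = (b ▶ a)·v` -/
theorem sliceR_leg (hα : IsUnitalAction α) (b : B) (a : A) (v : V) :
    sliceR (P.form.flip b) (HA.leg α (a ⊗ₜ v)) = α (P.lactA b a) v := by
  obtain ⟨t, rfl⟩ := P.swap.lactA_surjective b
  induction t with
  | zero => simp [sliceR]
  | add x y hx hy =>
    simp only [map_add, LinearMap.add_apply, ← hx, ← hy]
    simp [sliceR, LinearMap.lTensor_add]
  | tmul d b =>
    have h1 := P.sliceR_lTensor_mulRight b d (HA.leg α (a ⊗ₜ v))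
    rw [isLeg_leg HA.cop_Δ hα, sliceR_rTensor_flip, sliceR_T₁] at h1
    exact h1.symm

/-- `⟨a₍₁₎, b⟩ a₍₂₎·v = (a ◀ b)·v` -/
theorem sliceR_cop_leg (hα : IsUnitalAction α) (b : B) (a : A) (v : V) :
    sliceR (P.form.flip b) (HA.cop.leg α (a ⊗ₜ v)) = α (P.ractA b a) v := by
  obtain ⟨t, rfl⟩ := P.swap.lactA_surjective b
  induction t with
  | zero => simp [sliceR]
  | add x y hx hy =>
    simp only [map_add, LinearMap.add_apply, ← hx, ← hy]
    simp [sliceR, LinearMap.lTensor_add]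
  | tmul d b =>
    have h1 := P.sliceR_lTensor_mulRight b d (HA.cop.leg α (a ⊗ₜ v))
    rw [isLeg_leg (flip_symm HA.cop_Δ) hα, sliceR_rTensor_flip, sliceR_cop_T₁] at h1
    exact h1.symm

end Leg

/-! ### Evaluations at elements of `A` -/

theorem sliceR_T₁_B (a : A) (b x : B) :
    sliceR (P.form a) (HB.T₁ (b ⊗ₜ x)) = P.lactB (P.lactA x a) b := P.swap.sliceR_T₁ a b x

theorem sliceR_leg_B {V : Type*} [AddCommGroup V] [Module K V] {α : B →ₗ[K] V →ₗ[K] V}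
    (hα : IsUnitalAction α) (a : A) (b : B) (v : V) :
    sliceR (P.form a) (HB.leg α (b ⊗ₜ v)) = α (P.lactB a b) v := P.swap.sliceR_leg hα a b v

theorem sliceR_cop_leg_B {V : Type*} [AddCommGroup V] [Module K V] {α : B →ₗ[K] V →ₗ[K] V}
    (hα : IsUnitalAction α) (a : A) (b : B) (v : V) :
    sliceR (P.form a) (HB.cop.leg α (b ⊗ₜ v)) = α (P.ractB a b) v := P.swap.sliceR_cop_leg hα a b v

/-- `Δᶜᵒᵖ(b ▶ a)(1 ⊗ x) = b ▶ a₍₂₎ ⊗ a₍₁₎ x` -/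
theorem cop_T₁_lactA (b : B) (a x : A) :
    HA.cop.T₁ (P.lactA b a ⊗ₜ x) = (P.lactA b).rTensor A (HA.cop.T₁ (a ⊗ₜ x)) := by
  apply eq_of_sliceL _ P.eq_zero_of_form_flip
  intro b'
  have h1 : ∀ t : A ⊗[K] A, sliceL (P.form.flip b') ((P.lactA b).rTensor A t) =
      sliceL (P.form.flip (b' * b)) t := by
    intro t
    induction t with
    | zero => simp
    | add x y hx hy => simp only [map_add, hx, hy]
    | tmul p q => simp [P.form_mul_right]
  rw [h1, sliceL_cop_T₁, sliceL_cop_T₁, lactA_mul_left]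

/-! ### The faithful representation of the Heisenberg double -/

/-- The operators `y ↦ a (b ▶ y)` on `A`, for `a # b` in the Heisenberg double. -/
noncomputable def rep : A ⊗[K] B →ₗ[K] Module.End K A := composeAct (LinearMap.mul K A) P.lactA

@[simp] theorem rep_tmul (a : A) (b : B) (y : A) : P.rep (a ⊗ₜ b) y = a * P.lactA b y := rfl

theorem rep_lTensor_mulRight (d : B) (t : A ⊗[K] B) (y : A) :
    P.rep ((LinearMap.mulRight K d).lTensor A t) y = P.rep t (P.lactA d y) := by
  induction t with
  | zero => simp
  | add x y hx hy => simp only [map_add, LinearMap.add_apply, hx, hy]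
  | tmul p q => simp [lactA_mul_left]

theorem rep_rTensor_mulLeft (c : A) (t : A ⊗[K] B) (y : A) :
    P.rep ((LinearMap.mulLeft K c).rTensor B t) y = c * P.rep t y := by
  induction t with
  | zero => simp
  | add x y hx hy => simp only [map_add, LinearMap.add_apply, mul_add, hx, hy]
  | tmul p q => simp [mul_assoc]

/-- `∑ ⟨u, b⟩ a v` is `(a # b)(y) z` for `u ⊗ v = y₍₂₎ ⊗ y₍₁₎ z`. -/
theorem rep_mul_eq (t : A ⊗[K] B) (y z : A) : P.rep t y * z = LinearMap.mul' K A
    (((TensorProduct.rid K A).toLinearMap ∘ₗ (LinearMap.lTensorHom A).flip t ∘ₗ P.form).rTensor A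
      (HA.cop.T₁ (y ⊗ₜ z))) := by
  obtain ⟨n, u, v, hn⟩ := TensorProduct.exists_sum_tmul_eq (HA.cop.T₁ (y ⊗ₜ[K] z))
  have h1 : ∀ q, P.lactA q y * z = ∑ i, P.form (u i) q • v i := by
    intro q
    rw [← sliceL_cop_T₁, hn]
    simp
  rw [hn]
  induction t with
  | zero => simp
  | add x y hx hy =>
    rw [map_add, LinearMap.add_apply, add_mul, hx, hy]
    simp [TensorProduct.add_tmul, Finset.sum_add_distrib]
  | tmul p q => simp [mul_assoc, h1, Finset.mul_sum, mul_smul_comm, smul_mul_assoc]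

/-- By `rep_mul_eq` and the surjectivity of `T₁` for `Δᶜᵒᵖ`, an element `t` in the kernel satisfies
`(ι ⊗ ⟨u, ·⟩)(t) v = 0` for all `u` and `v`. -/
theorem rep_injective : Function.Injective P.rep := by
  rw [injective_iff_map_eq_zero]
  intro t ht
  have h1 : ∀ w : A ⊗[K] A, LinearMap.mul' K A (((TensorProduct.rid K A).toLinearMap ∘ₗ
      (LinearMap.lTensorHom A).flip t ∘ₗ P.form).rTensor A w) = 0 := by
    intro w
    obtain ⟨w, rfl⟩ := HA.cop.T₁.surjective w
    induction w with
    | zero => simp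
    | add x y hx hy => rw [map_add, map_add, map_add, hx, hy, add_zero]
    | tmul y z => rw [← rep_mul_eq, ht, LinearMap.zero_apply, zero_mul]
  apply eq_of_sliceR _ P.eq_zero_of_form
  intro u
  rw [map_zero]
  exact HA.nondegenerate.1 _ fun v => h1 (u ⊗ₜ v)

/-- `A` is a module algebra over `B`: `b ▶ (a (d ▶ y)) = (b₍₁₎ ▶ a) (b₍₂₎ d ▶ y)`. -/
theorem lactA_mul_lactA (b d : B) (a y : A) : P.lactA b (a * P.lactA d y) =
    P.rep ((P.lactA.flip a).rTensor B (HB.T₁ (b ⊗ₜ d))) y := by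
  apply HA.nondegenerate.eq_of_mul_right
  intro z
  have h2 : ∀ (x : A) (t : A ⊗[K] A), sliceL (P.form.flip b)
      ((LinearMap.mulRight K x).rTensor A t) = sliceL (P.form.flip (P.lactB x b)) t := by
    intro x t
    induction t with
    | zero => simp
    | add x y hx hy => simp only [map_add, hx, hy]
    | tmul p q => simp [P.form_mul_left]
  -- Both sides are `((d ▶ u ▶ b) ▶ a) v` for `u ⊗ v = y₍₂₎ ⊗ y₍₁₎ z`.
  rw [rep_mul_eq, ← sliceL_cop_T₁, T₁_mul_tmul, cop_T₁_lactA]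
  generalize HA.cop.T₁ (y ⊗ₜ[K] z) = t
  induction t with
  | zero => simp
  | add x y hx hy => simp only [map_add, hx, hy]
  | tmul u v =>
    have h3 : TensorProduct.rid K A ((P.form u).lTensor A ((P.lactA.flip a).rTensor B
        (HB.T₁ (b ⊗ₜ d)))) = P.lactA (P.lactB (P.lactA d u) b) a := by
      rw [← sliceR_T₁_B]
      generalize HB.T₁ (b ⊗ₜ[K] d) = t
      induction t with
      | zero => simp
      | add x y hx hy => simp only [map_add, LinearMap.add_apply, hx, hy]
      | tmul p q => simp
    simp [comulLeft_tmul, h2, sliceL_cop_T₁, h3]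

/-- `b ▶ (a y) = (b₍₁₎ ▶ a) (b₍₂₎ ▶ y)` -/
theorem lactA_mul_eq_rep (b : B) (a y : A) : P.lactA b (a * y) =
    P.rep (HB.leg P.lactA (b ⊗ₜ a)) y := by
  have h1 : P.lactA b ∘ₗ LinearMap.mulLeft K a = P.rep (HB.leg P.lactA (b ⊗ₜ a)) := by
    apply P.isUnitalAction_lactA.ext
    intro d y
    rw [← rep_lTensor_mulRight, isLeg_leg HB.cop_Δ P.isUnitalAction_lactA, ← lactA_mul_lactA]
    rfl
  exact LinearMap.congr_fun h1 y

theorem rep_heisenbergMul (h k : A ⊗[K] B) :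
    P.rep (P.heisenbergMul h k) = P.rep h * P.rep k := by
  have h1 : ∀ h k : A ⊗[K] B, ∀ y, P.rep (P.heisenbergMul h k) y = P.rep h (P.rep k y) := by
    intro h k y
    induction h with
    | zero => simp
    | add x y hx hy => simp only [map_add, LinearMap.add_apply, hx, hy]
    | tmul a b =>
      induction k with
      | zero => simp
      | add x y hx hy => simp only [map_add, LinearMap.add_apply, hx, hy]
      | tmul a' b' =>
        rw [heisenbergMul, composeAct_tmul, smashAct_tmul, rep_tmul, rep_tmul, lactA_mul_lactA,
          ← rep_rTensor_mulLeft]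
        rfl
  exact LinearMap.ext (h1 h k)

/-- `c (b ▶ (a w)) = c a₍₁₎ ((b ◀ a₍₂₎) ▶ w)` -/
theorem mul_lactA_mul (c : A) (b : B) (a w : A) : c * P.lactA b (a * w) =
    P.rep ((P.ractB.flip b).lTensor A (HA.T₂ (c ⊗ₜ a))) w := by
  have h1 : (LinearMap.mulLeft K c).rTensor B (HB.leg P.lactA (b ⊗ₜ a)) =
      (P.ractB.flip b).lTensor A (HA.T₂ (c ⊗ₜ a)) := by
    apply eq_of_sliceR _ P.eq_zero_of_form
    intro y
    have h2 : ∀ t : A ⊗[K] B, sliceR (P.form y) ((LinearMap.mulLeft K c).rTensor B t) =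
        c * sliceR (P.form y) t := by
      intro t
      induction t with
      | zero => simp
      | add x y hx hy => simp only [map_add, mul_add, hx, hy]
      | tmul p q => simp [mul_smul_comm]
    have h3 : ∀ t : A ⊗[K] A, sliceR (P.form y) ((P.ractB.flip b).lTensor A t) =
        sliceR (P.form.flip (P.lactB y b)) t := by
      intro t
      induction t with
      | zero => simp
      | add x y hx hy => simp only [map_add, hx, hy]
      | tmul p q => simp [← P.form_mul_left, ← P.form_mul_left']
    rw [h2, h3, sliceR_leg_B _ P.isUnitalAction_lactA, sliceR_T₂]
  rw [← h1, rep_rTensor_mulLeft, lactA_mul_eq_rep]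

/-! ### Coassociativity of the legs -/

section Leg

variable {V W : Type*} [AddCommGroup V] [Module K V] [AddCommGroup W] [Module K W]
  {α : A →ₗ[K] V →ₗ[K] V} {β : A →ₗ[K] W →ₗ[K] W}

/-- `(b ▶ a)₍₁₎·v ⊗ (b ▶ a)₍₂₎ = a₍₁₎·v ⊗ b ▶ a₍₂₎` -/
theorem leg_lactA (hα : IsUnitalAction α) (b : B) (a : A) (v : V) :
    HA.leg α (P.lactA b a ⊗ₜ v) = (P.lactA b).lTensor V (HA.leg α (a ⊗ₜ v)) := by
  apply eq_of_sliceR _ P.eq_zero_of_form_flip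
  intro y
  have h1 : ∀ t : V ⊗[K] A, sliceR (P.form.flip y) ((P.lactA b).lTensor V t) =
      sliceR (P.form.flip (y * b)) t := by
    intro t
    induction t with
    | zero => simp
    | add x y hx hy => simp only [map_add, hx, hy]
    | tmul p q => simp [P.form_mul_right]
  rw [h1, sliceR_leg _ hα, sliceR_leg _ hα, lactA_mul_left]

/-- `(a ◀ b)₍₂₎·v ⊗ (a ◀ b)₍₁₎ = a₍₂₎·v ⊗ a₍₁₎ ◀ b` -/
theorem cop_leg_ractA (hα : IsUnitalAction α) (b : B) (a : A) (v : V) :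
    HA.cop.leg α (P.ractA b a ⊗ₜ v) = (P.ractA b).lTensor V (HA.cop.leg α (a ⊗ₜ v)) := by
  apply eq_of_sliceR _ P.eq_zero_of_form_flip
  intro y
  have h1 : ∀ t : V ⊗[K] A, sliceR (P.form.flip y) ((P.ractA b).lTensor V t) =
      sliceR (P.form.flip (b * y)) t := by
    intro t
    induction t with
    | zero => simp
    | add x y hx hy => simp only [map_add, hx, hy]
    | tmul p q => simp [P.form_mul_right']
  rw [h1, sliceR_cop_leg _ hα, sliceR_cop_leg _ hα, ractA_mul_left]

/-- `a₍₂₎·v ⊗ c a₍₁₎`, by left covering -/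
theorem lTensor_mulLeft_cop_leg (P : Pairing HA HB) (hα : IsUnitalAction α) (c a : A) (v : V) :
    (LinearMap.mulLeft K c).lTensor V (HA.cop.leg α (a ⊗ₜ v)) =
      TensorProduct.comm K A V ((α.flip v).lTensor A (HA.T₂ (c ⊗ₜ a))) := by
  apply eq_of_sliceR _ P.eq_zero_of_form_flip
  intro y
  have h1 : ∀ t : V ⊗[K] A, sliceR (P.form.flip y) ((LinearMap.mulLeft K c).lTensor V t) =
      sliceR (P.form.flip (P.ractB c y)) t := by
    intro t
    induction t with
    | zero => simp
    | add x y hx hy => simp only [map_add, hx, hy]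
    | tmul p q => simp [P.form_mul_left']
  have h2 : ∀ t : A ⊗[K] A, sliceL (P.form.flip y) ((α.flip v).lTensor A t) =
      α (sliceL (P.form.flip y) t) v := by
    intro t
    induction t with
    | zero => simp
    | add x y hx hy => simp only [map_add, LinearMap.add_apply, hx, hy]
    | tmul p q => simp
  rw [h1, sliceR_cop_leg _ hα, sliceR_comm, h2, sliceL_T₂]

/-- `(a₍₁₎·v ⊗ a₍₂₎) ⊗ a₍₃₎ d` -/
theorem rTensor_leg_T₁ (P : Pairing HA HB) (hα : IsUnitalAction α) (a d : A) (v : V) :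
    (HA.leg α ∘ₗ (TensorProduct.mk K A V).flip v).rTensor A (HA.T₁ (a ⊗ₜ d)) =
      (TensorProduct.assoc K V A A).symm (HA.T₁.toLinearMap.lTensor V
        (TensorProduct.assoc K V A A (HA.leg α (a ⊗ₜ v) ⊗ₜ d))) := by
  apply eq_of_sliceR _ P.eq_zero_of_form_flip
  intro y
  have h1 : ∀ t : A ⊗[K] A, sliceR (P.form.flip y)
      ((HA.leg α ∘ₗ (TensorProduct.mk K A V).flip v).rTensor A t) =
      HA.leg α (sliceR (P.form.flip y) t ⊗ₜ v) := by
    intro t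
    induction t with
    | zero => simp
    | add x y hx hy => simp only [map_add, TensorProduct.add_tmul, hx, hy]
    | tmul p q => simp [← TensorProduct.smul_tmul']
  have h2 : ∀ t : V ⊗[K] A, sliceR (P.form.flip y) ((TensorProduct.assoc K V A A).symm
      (HA.T₁.toLinearMap.lTensor V (TensorProduct.assoc K V A A (t ⊗ₜ d)))) =
      (P.lactA (P.lactB d y)).lTensor V t := by
    intro t
    induction t with
    | zero => simp
    | add x y hx hy => simp only [map_add, TensorProduct.add_tmul, hx, hy]
    | tmul p q =>
      have h3 : ∀ s : A ⊗[K] A, sliceR (P.form.flip y) ((TensorProduct.assoc K V A A).symm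
          (p ⊗ₜ s)) = p ⊗ₜ sliceR (P.form.flip y) s := by
        intro s
        induction s with
        | zero => simp
        | add x y hx hy => simp only [map_add, TensorProduct.tmul_add, hx, hy]
        | tmul p q => simp
      simp [h3, sliceR_T₁]
  rw [h1, h2, sliceR_T₁, leg_lactA _ hα]

/-- Coassociativity `(a₍₁₎·v ⊗ a₍₂₎) ⊗ a₍₃₎·w` for the two maps `a ⊗ w ↦ a₍₂₎·w ⊗ a₍₁₎` and
`a ⊗ v ↦ a₍₁₎·v ⊗ a₍₂₎`. -/
theorem leg_cop_leg (P : Pairing HA HB) (hα : IsUnitalAction α) (hβ : IsUnitalAction β) (a : A)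
    (v : V) (w : W) :
    TensorProduct.comm K W (V ⊗[K] A) ((HA.leg α ∘ₗ (TensorProduct.mk K A V).flip v).lTensor W
      (HA.cop.leg β (a ⊗ₜ w))) =
    (TensorProduct.assoc K V A W).symm (((TensorProduct.comm K W A).toLinearMap ∘ₗ
      HA.cop.leg β).lTensor V (TensorProduct.assoc K V A W (HA.leg α (a ⊗ₜ v) ⊗ₜ w))) := by
  have key : (TensorProduct.comm K W (V ⊗[K] A)).toLinearMap ∘ₗ
        (HA.leg α ∘ₗ (TensorProduct.mk K A V).flip v).lTensor W ∘ₗ HA.cop.leg β ∘ₗ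
        TensorProduct.mk K A W a =
      (TensorProduct.assoc K V A W).symm.toLinearMap ∘ₗ ((TensorProduct.comm K W A).toLinearMap ∘ₗ
        HA.cop.leg β).lTensor V ∘ₗ (TensorProduct.assoc K V A W).toLinearMap ∘ₗ
        TensorProduct.mk K (V ⊗[K] A) W (HA.leg α (a ⊗ₜ v)) := by
    apply hβ.ext
    intro d w
    have h1 : ∀ t : A ⊗[K] A, TensorProduct.comm K W (V ⊗[K] A)
        ((HA.leg α ∘ₗ (TensorProduct.mk K A V).flip v).lTensor W ((β.flip w).rTensor A
          (TensorProduct.comm K A A t))) = (β.flip w).lTensor (V ⊗[K] A)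
          ((HA.leg α ∘ₗ (TensorProduct.mk K A V).flip v).rTensor A t) := by
      intro t
      induction t with
      | zero => simp
      | add x y hx hy => simp only [map_add, hx, hy]
      | tmul p q => simp
    have h2 : ∀ t : V ⊗[K] A, (TensorProduct.assoc K V A W).symm
        (((TensorProduct.comm K W A).toLinearMap ∘ₗ HA.cop.leg β).lTensor V
          (TensorProduct.assoc K V A W (t ⊗ₜ β d w))) =
        (β.flip w).lTensor (V ⊗[K] A) ((TensorProduct.assoc K V A A).symm
          (HA.T₁.toLinearMap.lTensor V (TensorProduct.assoc K V A A (t ⊗ₜ d)))) := by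
      intro t
      induction t with
      | zero => simp
      | add x y hx hy => simp only [map_add, TensorProduct.add_tmul, hx, hy]
      | tmul p q =>
        rw [TensorProduct.assoc_tmul, TensorProduct.assoc_tmul, LinearMap.lTensor_tmul,
          LinearMap.lTensor_tmul, LinearMap.comp_apply, leg_tmul_act (flip_symm HA.cop_Δ) hβ]
        simp only [LinearEquiv.coe_coe]
        generalize HA.T₁ (q ⊗ₜ[K] d) = s
        induction s with
        | zero => simp
        | add x y hx hy => simp only [map_add, TensorProduct.tmul_add, hx, hy]
        | tmul f g => simp
    simp only [LinearMap.comp_apply, LinearEquiv.coe_coe, TensorProduct.mk_apply]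
    rw [leg_tmul_act (flip_symm HA.cop_Δ) hβ, h1, rTensor_leg_T₁ P hα, h2]
  exact LinearMap.congr_fun key w

end Leg

/-! ### The adjoint action of `B` -/

/-- The defining property of the adjoint action of `B`:
`π(b₍₁₎·h) (b₍₂₎ d ▶ z) = b ▶ π(h) (d ▶ z)`. -/
theorem isAdjointAction_actB : HB.IsAdjointAction P.rep P.actB P.lactA := by
  intro h z b d
  induction h with
  | zero =>
    have h1 : ∀ t : B ⊗[K] B, intertwine P.rep P.actB P.lactA 0 z t = 0 := by
      intro t
      induction t with
      | zero => simp
      | add x y hx hy => simp only [map_add, hx, hy, add_zero]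
      | tmul p q => simp
    simp [h1]
  | add h k hh hk =>
    have h1 : ∀ t : B ⊗[K] B, intertwine P.rep P.actB P.lactA (h + k) z t =
        intertwine P.rep P.actB P.lactA h z t + intertwine P.rep P.actB P.lactA k z t := by
      intro t
      induction t with
      | zero => simp
      | add x y hx hy => rw [map_add, hx, hy, map_add, map_add]; abel
      | tmul p q => simp
    simp only [h1, hh, hk, map_add, LinearMap.add_apply]
  | tmul a x =>
    -- `r ⊗ s ⊗ q ↦ r (ad(s)(x) q ▶ z)`
    let F : A ⊗[K] (B ⊗[K] B) →ₗ[K] A := LinearMap.mul' K A ∘ₗ (P.lactA.flip z ∘ₗ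
      LinearMap.mul' K B ∘ₗ (HB.ad.flip x).rTensor B).lTensor A
    have h1 : ∀ t : B ⊗[K] B, intertwine P.rep P.actB P.lactA (a ⊗ₜ x) z t =
        F (TensorProduct.assoc K A B B ((HB.leg P.lactA ∘ₗ
          (TensorProduct.mk K B A).flip a).rTensor B t)) := by
      intro t
      induction t with
      | zero => simp
      | add x y hx hy => simp only [map_add, hx, hy]
      | tmul p q =>
        rw [intertwine_tmul, actB, twistAct_tmul]
        simp only [LinearMap.rTensor_tmul, LinearMap.comp_apply, LinearMap.flip_apply,
          TensorProduct.mk_apply]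
        generalize HB.leg P.lactA (p ⊗ₜ[K] a) = s
        induction s with
        | zero => simp
        | add x y hx hy =>
          simp only [map_add, TensorProduct.add_tmul, LinearMap.add_apply, hx, hy]
        | tmul r s => simp [F, lactA_mul_left]
    have h2 : ∀ t : A ⊗[K] B, F (HB.T₁.toLinearMap.lTensor A (TensorProduct.assoc K A B B
        (t ⊗ₜ d))) = P.rep t (P.lactA x (P.lactA d z)) := by
      intro t
      induction t with
      | zero => simp
      | add x y hx hy =>
        simp only [map_add, TensorProduct.add_tmul, LinearMap.add_apply, hx, hy]
      | tmul r s =>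
        have h3 := adjoint_T₁ HB.cop_Δ HB.antipode_T₁ (ad := HB.ad) (fun _ _ => rfl) s x d
        simp [F, h3, lactA_mul_left]
    rw [h1, rTensor_leg_T₁ P.swap P.isUnitalAction_lactA, LinearEquiv.apply_symm_apply, h2,
      ← lactA_mul_eq_rep, rep_tmul]

/-! ### The adjoint action of `A` -/

/-- `(b ◀ S⁻¹(a₍₂₎)) ▶ (a₍₁₎ w) = a (b ▶ w)` -/
theorem ractBInv_lactA_cop_T₁ (b : B) (a w : A) :
    TensorProduct.lift (P.lactA ∘ₗ P.ractBInv.flip b) (HA.cop.T₁ (a ⊗ₜ w)) =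
      a * P.lactA b w := by
  obtain ⟨t, rfl⟩ := P.swap.ractA_surjective b
  induction t with
  | zero =>
    have h1 : ∀ t : A ⊗[K] A, TensorProduct.lift (P.lactA ∘ₗ P.ractBInv.flip 0) t = 0 := by
      intro t
      induction t with
      | zero => rw [map_zero]
      | add x y hx hy => rw [map_add, hx, hy, add_zero]
      | tmul p q => simp
    rw [map_zero, h1]
    simp
  | add x y hx hy =>
    have h1 : ∀ (b b' : B) (t : A ⊗[K] A),
        TensorProduct.lift (P.lactA ∘ₗ P.ractBInv.flip (b + b')) t =
        TensorProduct.lift (P.lactA ∘ₗ P.ractBInv.flip b) t +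
        TensorProduct.lift (P.lactA ∘ₗ P.ractBInv.flip b') t := by
      intro b b' t
      induction t with
      | zero => simp only [map_zero, add_zero]
      | add x y hx hy => rw [map_add, hx, hy, map_add, map_add]; abel
      | tmul p q => simp
    rw [map_add, h1, hx, hy, map_add, LinearMap.add_apply, mul_add]
  | tmul e b =>
    change TensorProduct.lift (P.lactA ∘ₗ P.ractBInv.flip (P.ractB e b)) (HA.cop.T₁ (a ⊗ₜ w)) =
      a * P.lactA (P.ractB e b) w
    -- The element `e` covers `S⁻¹(a₍₂₎)`: `e S⁻¹(a₍₂₎) ⊗ a₍₁₎` comes from `a₍₁₎ ⊗ a₍₂₎ S(e)`.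
    have h1 : ∀ t : A ⊗[K] A, TensorProduct.lift (P.lactA ∘ₗ P.ractBInv.flip (P.ractB e b)) t =
        TensorProduct.lift (P.lactA ∘ₗ P.ractBInv.flip b)
          ((LinearMap.mulRight K (HA.antipode e)).rTensor A t) := by
      intro t
      induction t with
      | zero => simp
      | add x y hx hy => simp only [map_add, hx, hy]
      | tmul p q =>
        have := P.swap.ractA_mul_left e (HA.antipode.symm p) b
        simp only [swap] at this
        simp [ractBInv, HA.antipode_symm_mul, this]
    apply HA.nondegenerate.eq_of_mul_left
    intro c
    -- `f ⊗ g ⊗ v ↦ f (b ◀ S⁻¹(v) g ▶ w)`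
    let F : A ⊗[K] (A ⊗[K] A) →ₗ[K] A := LinearMap.mul' K A ∘ₗ (P.lactA.flip w ∘ₗ
      P.ractB.flip b ∘ₗ HA.antipode.symm.toLinearMap ∘ₗ LinearMap.mul' K A ∘ₗ
        HA.antipode.toLinearMap.rTensor A).lTensor A
    have h2 : ∀ s : A ⊗[K] A, c * TensorProduct.lift (P.lactA ∘ₗ P.ractBInv.flip b)
        ((LinearMap.mulRight K w).lTensor A (TensorProduct.comm K A A s)) =
        F (TensorProduct.assoc K A A A (HA.T₂.toLinearMap.rTensor A
        ((TensorProduct.assoc K A A A).symm (c ⊗ₜ s)))) := by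
      intro s
      induction s with
      | zero => simp
      | add x y hx hy => simp only [map_add, TensorProduct.tmul_add, mul_add, hx, hy]
      | tmul y x =>
        simp only [TensorProduct.comm_tmul, LinearMap.lTensor_tmul, LinearMap.mulRight_apply,
          TensorProduct.lift.tmul, LinearMap.comp_apply, LinearMap.flip_apply, mul_lactA_mul,
          TensorProduct.assoc_symm_tmul, LinearMap.rTensor_tmul, LinearEquiv.coe_coe]
        generalize HA.T₂ (c ⊗ₜ[K] y) = s
        induction s with
        | zero => simp
        | add x y hx hy =>
          simp only [map_add, TensorProduct.add_tmul, LinearMap.add_apply, hx, hy]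
        | tmul f g =>
          have := P.swap.ractA_mul_left (HA.antipode.symm x) g b
          simp only [swap] at this
          simp [F, ractBInv, HA.antipode_symm_mul, this]
    have h3 : ∀ s : A ⊗[K] A, F (HA.T₁.toLinearMap.lTensor A (TensorProduct.assoc K A A A
        (s ⊗ₜ HA.antipode e))) = sliceR HA.counit s * P.lactA (P.ractB e b) w := by
      intro s
      induction s with
      | zero => simp
      | add x y hx hy => simp only [map_add, TensorProduct.add_tmul, add_mul, hx, hy]
      | tmul f g => simp [F, HA.antipode_T₁, smul_mul_assoc]
    have h4 := HA.coassoc_apply (c ⊗ₜ (a ⊗ₜ HA.antipode e))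
    rw [LinearMap.lTensor_tmul, LinearEquiv.coe_coe] at h4
    rw [h1, ← T₁_covered_comm _ _ (flip_symm HA.cop_Δ), h2, h4, TensorProduct.assoc_symm_tmul,
      LinearMap.rTensor_tmul, LinearEquiv.coe_coe, h3, sliceR_counit_T₂]
    simp [mul_assoc]

/-- The defining property of the adjoint action of `A`: `π(a₍₂₎·h) a₍₁₎ w = a π(h) w`. -/
theorem lift_rep_actA (h : A ⊗[K] B) (a w : A) :
    TensorProduct.lift (P.rep ∘ₗ P.actA.flip h) (HA.cop.T₁ (a ⊗ₜ w)) = a * P.rep h w := by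
  induction h with
  | zero =>
    have h1 : ∀ t : A ⊗[K] A, TensorProduct.lift (P.rep ∘ₗ P.actA.flip 0) t = 0 := by
      intro t
      induction t with
      | zero => rw [map_zero]
      | add x y hx hy => rw [map_add, hx, hy, add_zero]
      | tmul p q => simp
    rw [h1]
    simp
  | add h k hh hk =>
    have h1 : ∀ t : A ⊗[K] A, TensorProduct.lift (P.rep ∘ₗ P.actA.flip (h + k)) t =
        TensorProduct.lift (P.rep ∘ₗ P.actA.flip h) t +
        TensorProduct.lift (P.rep ∘ₗ P.actA.flip k) t := by
      intro t
      induction t with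
      | zero => simp only [map_zero, add_zero]
      | add x y hx hy => rw [map_add, hx, hy, map_add, map_add]; abel
      | tmul p q => simp
    rw [h1, hh, hk, map_add, LinearMap.add_apply, mul_add]
  | tmul x b =>
    -- `p ⊗ q ↦ p₍₂₎ ⊗ ((b ◀ S⁻¹(p₍₁₎)) ▶ q)`
    let G : A ⊗[K] A →ₗ[K] A ⊗[K] A := (TensorProduct.comm K A A).toLinearMap ∘ₗ
      TensorProduct.lift ((LinearMap.rTensorHom A ∘ₗ P.lactA.flip).flip ∘ₗ
        HA.leg P.ractBInv ∘ₗ (TensorProduct.mk K A B).flip b)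
    have hG : ∀ p q, G (p ⊗ₜ q) = TensorProduct.comm K A A
        ((P.lactA.flip q).rTensor A (HA.leg P.ractBInv (p ⊗ₜ b))) := fun _ _ => rfl
    have h1 : ∀ t : A ⊗[K] A, TensorProduct.lift (P.rep ∘ₗ P.actA.flip (x ⊗ₜ b)) t =
        LinearMap.mul' K A ((HA.adInv.flip x).rTensor A (G t)) := by
      intro t
      induction t with
      | zero => simp only [map_zero]
      | add x y hx hy => simp only [map_add, hx, hy]
      | tmul p q =>
        have h2 : P.actA p (x ⊗ₜ b) = TensorProduct.comm K B A
          ((HA.adInv.flip x).lTensor B (HA.leg P.ractBInv (p ⊗ₜ b))) := rfl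
        rw [hG, TensorProduct.lift.tmul, LinearMap.comp_apply, LinearMap.flip_apply, h2]
        generalize HA.leg P.ractBInv (p ⊗ₜ b) = s
        induction s with
        | zero => simp
        | add x y hx hy => simp only [map_add, LinearMap.add_apply, hx, hy]
        | tmul r s => simp
    have h2 : G (HA.cop.T₁ (a ⊗ₜ w)) = HA.cop.T₁ (a ⊗ₜ P.lactA b w) := by
      apply eq_of_sliceL _ P.eq_zero_of_form_flip
      intro y
      have h3 : ∀ t : A ⊗[K] A, sliceL (P.form.flip y) (G t) =
          TensorProduct.lift (P.lactA ∘ₗ P.ractBInv.flip b) ((P.lactA y).rTensor A t) := by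
        intro t
        induction t with
        | zero => simp only [map_zero]
        | add x y hx hy => simp only [map_add, hx, hy]
        | tmul p q =>
          have h4 : ∀ s : B ⊗[K] A, sliceL (P.form.flip y) (TensorProduct.comm K A A
              ((P.lactA.flip q).rTensor A s)) = P.lactA (sliceR (P.form.flip y) s) q := by
            intro s
            induction s with
            | zero => simp
            | add x y hx hy => simp only [map_add, LinearMap.add_apply, hx, hy]
            | tmul r s => simp
          rw [hG, h4, P.sliceR_leg P.isUnitalAction_ractBInv]
          simp
      rw [h3, ← cop_T₁_lactA, ractBInv_lactA_cop_T₁, sliceL_cop_T₁]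
    have h5 : ∀ a b, LinearMap.mul' K A (HA.antipode.symm.toLinearMap.rTensor A
        (HA.cop.T₁ (a ⊗ₜ b))) = HA.cop.counit a • b := by
      intro a b
      rw [HA.antipode_symm_cop_T₁, counit_cop HA.cop_Δ]
    rw [h1, h2, adjoint_T₁ (flip_symm HA.cop_Δ) h5 (fun _ _ => rfl), rep_tmul, mul_assoc]

theorem isAdjointAction_actA : HA.cop.IsAdjointAction P.rep P.actA (LinearMap.mul K A) := by
  intro h z b d
  have h1 : ∀ t : A ⊗[K] A, intertwine P.rep P.actA (LinearMap.mul K A) h z t =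
      TensorProduct.lift (P.rep ∘ₗ P.actA.flip h) ((LinearMap.mulRight K z).lTensor A t) := by
    intro t
    induction t with
    | zero => simp only [map_zero]
    | add x y hx hy => simp only [map_add, hx, hy]
    | tmul p q => simp
  rw [h1, ← T₁_tmul_mul, lift_rep_actA]
  rfl

end Pairing

/-! ### Diagonal actions and legs of adjoint actions -/

section Smash

variable {K C V : Type*} [Field K] [NonUnitalRing C] [Module K C] [IsScalarTower K C C]
  [SMulCommClass K C C] [AddCommGroup V] [Module K V]

open MultiplierHopfAlgebra

/-- The diagonal action of `C` on `V ⊗ C` is unital. -/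
theorem isUnitalAction_smashAct (H : MultiplierHopfAlgebra K C) {α : C →ₗ[K] V →ₗ[K] V}
    (hα : IsUnitalAction α) : IsUnitalAction (smashAct H α) := by
  refine ⟨fun b b' w => ?_, ?_⟩
  · induction w with
    | zero => simp
    | add x y hx hy => simp only [map_add, hx, hy]
    | tmul v d =>
      rw [smashAct_tmul, smashAct_tmul, T₁_mul_tmul]
      generalize H.T₁ (b' ⊗ₜ[K] d) = s
      induction s with
      | zero => simp
      | add x y hx hy => simp only [map_add, hx, hy]
      | tmul x y =>
        rw [comulLeft_tmul, LinearMap.rTensor_tmul, smashAct_tmul, ← LinearMap.rTensor_comp_apply]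
        congr 2
        ext z
        simp [hα.mul]
  · rw [← LinearMap.range_eq_top, eq_top_iff, ← TensorProduct.span_tmul_eq_top, Submodule.span_le]
    rintro _ ⟨w, a, rfl⟩
    obtain ⟨t, rfl⟩ := hα.surjective w
    induction t with
    | zero => simp
    | add x y hx hy =>
      rw [map_add, TensorProduct.add_tmul]
      exact add_mem hx hy
    | tmul e v =>
      have h1 : ∀ t : C ⊗[K] C, (α.flip v).rTensor C t ∈
          LinearMap.range (TensorProduct.lift (smashAct H α)) := by
        intro t
        obtain ⟨t, rfl⟩ := H.T₁.surjective t
        induction t with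
        | zero => simp
        | add x y hx hy =>
          rw [map_add, map_add]
          exact add_mem hx hy
        | tmul c d => exact ⟨c ⊗ₜ (v ⊗ₜ d), rfl⟩
      simpa using h1 (e ⊗ₜ a)

end Smash

namespace MultiplierHopfAlgebra

section AdjointAction

variable {K A : Type*} [Field K] [NonUnitalRing A] [Module K A] [IsScalarTower K A A]
  [SMulCommClass K A A] {H H' : MultiplierHopfAlgebra K A}
  {M Z D : Type*} [AddCommGroup M] [Module K M] [AddCommGroup Z] [Module K Z]
  [AddCommGroup D] [Module K D]
  {π : M →ₗ[K] Module.End K Z} {γ : A →ₗ[K] Module.End K M} {l : A →ₗ[K] Module.End K Z}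

/-- `π(b₍₁₎·h) (b₍₂₎ z) = b π(h) z` -/
theorem IsAdjointAction.leg (hγ : H.IsAdjointAction π γ l)
    (h : ∀ a : A, H'.Δ a = flipMultiplier (H.Δ a)) (hl : IsUnitalAction l) (m : M) (b : A) (z : Z) :
    TensorProduct.lift (π ∘ₗ γ.flip m) (TensorProduct.comm K Z A (H'.leg l (b ⊗ₜ z))) =
      l b (π m z) := by
  have key : TensorProduct.lift (π ∘ₗ γ.flip m) ∘ₗ (TensorProduct.comm K Z A).toLinearMap ∘ₗ
      H'.leg l ∘ₗ TensorProduct.mk K A Z b = l b ∘ₗ π m := by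
    apply hl.ext
    intro d z
    simp only [LinearMap.comp_apply, LinearEquiv.coe_coe, TensorProduct.mk_apply]
    rw [leg_tmul_act (flip_symm h) hl, ← hγ]
    generalize H.T₁ (b ⊗ₜ[K] d) = s
    induction s with
    | zero => simp
    | add x y hx hy => simp only [map_add, hx, hy]
    | tmul x y => simp
  exact LinearMap.congr_fun key z

/-- `b·(h (y·k)) = (b₍₁₎·h) ((b₍₂₎ y)·k)` for `y` in a module `D` over `A` that acts on `M` in a
compatible way. -/
theorem IsAdjointAction.act_mul_leg (hγ : H.IsAdjointAction π γ l)
    (h : ∀ a : A, H'.Δ a = flipMultiplier (H.Δ a)) (hl : IsUnitalAction l)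
    (hπ : Function.Injective π) {m : M →ₗ[K] M →ₗ[K] M} (hm : ∀ h k, π (m h k) = π h * π k)
    {δ : A →ₗ[K] D →ₗ[K] D} (hδ : IsUnitalAction δ) {act : D →ₗ[K] M →ₗ[K] M}
    (hact : ∀ b y k, act (δ b y) k = γ b (act y k)) (b : A) (y : D) (r k : M) :
    TensorProduct.lift (m.flip.compl₁₂ (act.flip k) (γ.flip r)) (H'.leg δ (b ⊗ₜ y)) =
      γ b (m r (act y k)) := by
  have key : TensorProduct.lift (m.flip.compl₁₂ (act.flip k) (γ.flip r)) ∘ₗ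
      H'.leg δ ∘ₗ TensorProduct.mk K A D b = γ b ∘ₗ m r ∘ₗ act.flip k := by
    apply hδ.ext
    intro d y
    simp only [LinearMap.comp_apply, TensorProduct.mk_apply, LinearMap.flip_apply]
    rw [leg_tmul_act (flip_symm h) hδ, hact, hγ.act_mul hπ hl.surjective hm]
    generalize H.T₁ (b ⊗ₜ[K] d) = s
    induction s with
    | zero => simp
    | add x y hx hy => simp only [map_add, hx, hy]
    | tmul x y => simp [hact]
  exact LinearMap.congr_fun key y

end AdjointAction

end MultiplierHopfAlgebra

section Adjoint

variable {K A : Type*} [Field K] [NonUnitalRing A] [Module K A] [IsScalarTower K A A]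
  [SMulCommClass K A A]

theorem RegularMultiplierHopfAlgebra.ad_surjective (H : RegularMultiplierHopfAlgebra K A) :
    Function.Surjective (TensorProduct.lift H.ad) := by
  have h1 : TensorProduct.lift H.ad = LinearMap.mul' K A ∘ₗ
      (H.antipode.lTensor A).toLinearMap ∘ₗ (TensorProduct.comm K A A).toLinearMap ∘ₗ
      H.cop.T₁.toLinearMap := TensorProduct.lift_mk_compr₂ _
  rw [h1]
  exact H.mul'_surjective.comp ((H.antipode.lTensor A).surjective.comp
    ((TensorProduct.comm K A A).surjective.comp H.cop.T₁.surjective))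

theorem RegularMultiplierHopfAlgebra.adInv_surjective (H : RegularMultiplierHopfAlgebra K A) :
    Function.Surjective (TensorProduct.lift H.adInv) := by
  have h1 : TensorProduct.lift H.adInv = LinearMap.mul' K A ∘ₗ
      (H.antipode.symm.lTensor A).toLinearMap ∘ₗ (TensorProduct.comm K A A).toLinearMap ∘ₗ
      H.T₁.toLinearMap := TensorProduct.lift_mk_compr₂ _
  rw [h1]
  exact H.mul'_surjective.comp ((H.antipode.symm.lTensor A).surjective.comp
    ((TensorProduct.comm K A A).surjective.comp H.T₁.surjective))

end Adjoint

namespace Pairing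

open MultiplierHopfAlgebra

variable {K A B : Type*} [Field K]
  [NonUnitalRing A] [Module K A] [IsScalarTower K A A] [SMulCommClass K A A]
  [NonUnitalRing B] [Module K B] [IsScalarTower K B B] [SMulCommClass K B B]
  {HA : RegularMultiplierHopfAlgebra K A} {HB : RegularMultiplierHopfAlgebra K B}
  (P : Pairing HA HB)

/-! ### The algebra `B` acts on the Drinfel'd double -/

/-- The map `a ⊗ b ↦ a ◀ S⁻¹(b₍₂₎) ⊗ b₍₁₎` -/
noncomputable def untwist : A ⊗[K] B →ₗ[K] A ⊗[K] B :=
  HB.cop.leg P.ractAInv ∘ₗ (TensorProduct.comm K A B).toLinearMap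

theorem untwist_tmul (a : A) (b : B) :
    P.untwist (a ⊗ₜ b) = HB.cop.leg P.ractAInv (b ⊗ₜ a) := rfl

theorem untwist_surjective : Function.Surjective P.untwist :=
  (leg_surjective (flip_symm HB.cop_Δ) P.isUnitalAction_ractAInv).comp
    (TensorProduct.comm K A B).surjective

theorem twist_tmul (b : B) (a : A) :
    P.twist (b ⊗ₜ a) = P.untwist (HB.leg P.lactA (b ⊗ₜ a)) := rfl

theorem leg_ractAInv (b b' : B) (a : A) : HB.leg P.lactA (b ⊗ₜ P.ractAInv b' a) =
    (P.ractAInv b').rTensor B (HB.leg P.lactA (b ⊗ₜ a)) := by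
  apply eq_of_sliceR _ P.eq_zero_of_form
  intro y
  have h1 : ∀ t : A ⊗[K] B, sliceR (P.form y) ((P.ractAInv b').rTensor B t) =
      P.ractAInv b' (sliceR (P.form y) t) := by
    intro t
    induction t with
    | zero => simp
    | add x y hx hy => simp only [map_add, hx, hy]
    | tmul p q => simp
  rw [h1, sliceR_leg_B _ P.isUnitalAction_lactA, sliceR_leg_B _ P.isUnitalAction_lactA]
  exact P.lactA_ractA _ _ _

theorem doubleLeftMulB_tmul (b d : B) (a : A) : P.doubleLeftMulB b (a ⊗ₜ d) =
    (LinearMap.mulRight K d).lTensor A (P.untwist (HB.leg P.lactA (b ⊗ₜ a))) := rfl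

/-- The bijection `untwist` turns the operators `a ⊗ d ↦ b₍₁₎ ▶ a ⊗ b₍₂₎ d` into the left
multiplication by `b` on the Drinfel'd double. -/
theorem doubleLeftMulB_untwist (b : B) (w : A ⊗[K] B) : P.doubleLeftMulB b (P.untwist w) =
    P.untwist (smashAct HB.toMultiplierHopfAlgebra P.lactA b w) := by
  induction w with
  | zero => simp
  | add x y hx hy => simp only [map_add, hx, hy]
  | tmul a d =>
    have key : P.doubleLeftMulB b ∘ₗ P.untwist ∘ₗ (TensorProduct.mk K A B).flip d =
        P.untwist ∘ₗ smashAct HB.toMultiplierHopfAlgebra P.lactA b ∘ₗ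
          (TensorProduct.mk K A B).flip d := by
      apply P.isUnitalAction_ractAInv.ext
      intro f a
      simp only [LinearMap.comp_apply, LinearMap.flip_apply, TensorProduct.mk_apply]
      rw [smashAct_tmul, ← isLeg_leg HB.cop_Δ P.isUnitalAction_lactA, leg_ractAInv, untwist_tmul,
        leg_tmul_act (flip_symm HB.cop_Δ) P.isUnitalAction_ractAInv]
      obtain ⟨n, x, y, hn⟩ := TensorProduct.exists_sum_tmul_eq (HB.T₁ (d ⊗ₜ[K] f))
      have h1 : ∀ i, P.doubleLeftMulB b (P.ractAInv (y i) a ⊗ₜ x i) =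
          (LinearMap.mulRight K (x i)).lTensor A (P.untwist
            ((P.ractAInv (y i)).rTensor B (HB.leg P.lactA (b ⊗ₜ a)))) := by
        intro i
        rw [doubleLeftMulB_tmul, leg_ractAInv]
      have h2 : ∀ t : A ⊗[K] B, ∑ i, (LinearMap.mulRight K (x i)).lTensor A (P.untwist
            ((P.ractAInv (y i)).rTensor B t)) =
          P.untwist ((LinearMap.mulRight K d).lTensor A ((P.ractAInv f).rTensor B t)) := by
        intro t
        induction t with
        | zero => simp
        | add x y hx hy => simp only [map_add, Finset.sum_add_distrib, hx, hy]
        | tmul r s =>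
          have h3 : ∀ (x : B) (t : B ⊗[K] B), (LinearMap.mulRight K x).lTensor A
              ((P.ractAInv.flip r).rTensor B (TensorProduct.comm K B B t)) =
              (P.ractAInv.flip r).rTensor B (TensorProduct.comm K B B
                ((LinearMap.mulRight K x).rTensor B t)) := by
            intro x t
            induction t with
            | zero => simp
            | add x y hx hy => simp only [map_add, hx, hy]
            | tmul p q => simp
          simp only [LinearMap.rTensor_tmul, LinearMap.lTensor_tmul, LinearMap.mulRight_apply,
            untwist_tmul, leg_tmul_act (flip_symm HB.cop_Δ) P.isUnitalAction_ractAInv, h3,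
            ← comulLeft_tmul, T₁_mul_tmul, hn, map_sum]
      rw [← h2, hn]
      simp [h1]
    exact LinearMap.congr_fun key a

theorem isUnitalAction_doubleLeftMulB : IsUnitalAction P.doubleLeftMulB := by
  have hP := isUnitalAction_smashAct HB.toMultiplierHopfAlgebra P.isUnitalAction_lactA
  refine ⟨fun b b' w => ?_, fun w => ?_⟩
  · obtain ⟨w, rfl⟩ := P.untwist_surjective w
    simp only [doubleLeftMulB_untwist, hP.mul]
  · obtain ⟨w, rfl⟩ := P.untwist_surjective w
    obtain ⟨t, rfl⟩ := hP.surjective w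
    refine ⟨P.untwist.lTensor B t, ?_⟩
    induction t with
    | zero => simp
    | add x y hx hy => simp only [map_add, hx, hy]
    | tmul b w => simp [doubleLeftMulB_untwist]

/-! ### The commutation relation between the two adjoint actions -/

/-- `b₍₂₎ ▶ ((S⁻¹(S(c) b₍₁₎) ▶ r) w) = (c ▶ r) (b ▶ w)`, since `b₍₂₎ S⁻¹(b₍₁₎) c = ε(b) c` -/
theorem lactA_antipode_T₂ (b c : B) (r w : A) :
    TensorProduct.lift (P.lactA.flip ∘ₗ LinearMap.mulRight K w ∘ₗ P.lactA.flip r ∘ₗ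
      HB.antipode.symm.toLinearMap) (HB.T₂ (HB.antipode c ⊗ₜ b)) =
      P.lactA c r * P.lactA b w := by
  have hlin : ∀ t : B ⊗[K] B, ∃ f : A →ₗ[K] A, ∀ w, TensorProduct.lift (P.lactA.flip ∘ₗ
      LinearMap.mulRight K w ∘ₗ P.lactA.flip r ∘ₗ HB.antipode.symm.toLinearMap) t = f w := by
    intro t
    induction t with
    | zero => exact ⟨0, fun w => by simp⟩
    | add x y hx hy =>
      obtain ⟨f, hf⟩ := hx
      obtain ⟨g, hg⟩ := hy
      exact ⟨f + g, fun w => by rw [map_add, hf, hg, LinearMap.add_apply]⟩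
    | tmul x s =>
      exact ⟨P.lactA s ∘ₗ LinearMap.mulLeft K (P.lactA (HB.antipode.symm x) r), fun w => by simp⟩
  obtain ⟨f, hf⟩ := hlin (HB.T₂ (HB.antipode c ⊗ₜ b))
  have key : f = LinearMap.mulLeft K (P.lactA c r) ∘ₗ P.lactA b := by
    apply P.isUnitalAction_lactA.ext
    intro d w
    rw [← hf]
    -- `x ⊗ u ⊗ v ↦ (S⁻¹(x S(u)) ▶ r) (v ▶ w)`
    let F : B ⊗[K] (B ⊗[K] B) →ₗ[K] A := LinearMap.mul' K A ∘ₗ TensorProduct.map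
      (P.lactA.flip r ∘ₗ HB.antipode.symm.toLinearMap ∘ₗ LinearMap.mul' K B ∘ₗ
        HB.antipode.toLinearMap.lTensor B) (P.lactA.flip w) ∘ₗ
      (TensorProduct.assoc K B B B).symm.toLinearMap
    have h1 : ∀ t : B ⊗[K] B, TensorProduct.lift (P.lactA.flip ∘ₗ
        LinearMap.mulRight K (P.lactA d w) ∘ₗ P.lactA.flip r ∘ₗ HB.antipode.symm.toLinearMap) t =
        F (HB.T₁.toLinearMap.lTensor B (TensorProduct.assoc K B B B (t ⊗ₜ d))) := by
      intro t
      induction t with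
      | zero => simp
      | add x y hx hy => simp only [map_add, TensorProduct.add_tmul, hx, hy]
      | tmul x s =>
        simp only [TensorProduct.lift.tmul, LinearMap.comp_apply, LinearMap.flip_apply,
          LinearMap.mulRight_apply, LinearEquiv.coe_coe, lactA_mul_lactA,
          TensorProduct.assoc_tmul, LinearMap.lTensor_tmul]
        generalize HB.T₁ (s ⊗ₜ[K] d) = t
        induction t with
        | zero => simp
        | add x y hx hy =>
          simp only [map_add, TensorProduct.tmul_add, LinearMap.add_apply, hx, hy]
        | tmul u v => simp [F, HB.antipode_symm_mul, lactA_mul_left]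
    have h2 : ∀ t : B ⊗[K] B, F (TensorProduct.assoc K B B B (HB.T₂.toLinearMap.rTensor B
        ((TensorProduct.assoc K B B B).symm (HB.antipode c ⊗ₜ t)))) =
        P.lactA c r * P.lactA (sliceL HB.counit t) w := by
      intro t
      induction t with
      | zero => simp
      | add x y hx hy =>
        simp only [map_add, TensorProduct.tmul_add, LinearMap.add_apply, mul_add, hx, hy]
      | tmul u v => simp [F, HB.antipode_T₂, smul_mul_assoc, mul_smul_comm]
    have h3 := HB.coassoc_apply (HB.antipode c ⊗ₜ (b ⊗ₜ d))
    rw [LinearMap.lTensor_tmul, LinearEquiv.coe_coe, TensorProduct.assoc_symm_tmul,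
      LinearMap.rTensor_tmul, LinearEquiv.coe_coe] at h3
    rw [h1, ← h3, h2, sliceL_counit_T₁]
    simp [lactA_mul_left]
  rw [hf, key]
  rfl

section Spread

variable {N N' : Type*} [AddCommGroup N] [Module K N] [AddCommGroup N'] [Module K N']

/-- The map `p ⊗ q ↦ F(p, b₍₁₎) ⊗ (b₍₂₎ ▶ q)`, for a bilinear map `F` on `A × B`. -/
noncomputable def spread (F : A →ₗ[K] B →ₗ[K] N) (b : B) : A ⊗[K] A →ₗ[K] N ⊗[K] A :=
  (TensorProduct.comm K A N).toLinearMap ∘ₗ TensorProduct.lift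
    ((LinearMap.lTensorHom A ∘ₗ F).compl₂ (HB.cop.leg P.lactA ∘ₗ TensorProduct.mk K B A b))

theorem spread_tmul (F : A →ₗ[K] B →ₗ[K] N) (b : B) (p q : A) : P.spread F b (p ⊗ₜ q) =
    TensorProduct.comm K A N ((F p).lTensor A (HB.cop.leg P.lactA (b ⊗ₜ q))) := rfl

theorem spread_compr₂ (F : A →ₗ[K] B →ₗ[K] N) (g : N →ₗ[K] N') (b : B) (t : A ⊗[K] A) :
    P.spread (F.compr₂ g) b t = g.rTensor A (P.spread F b t) := by
  induction t with
  | zero => simp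
  | add x y hx hy => simp only [map_add, hx, hy]
  | tmul p q =>
    rw [spread_tmul, spread_tmul]
    generalize HB.cop.leg P.lactA (b ⊗ₜ[K] q) = s
    induction s with
    | zero => simp
    | add x y hx hy => simp only [map_add, hx, hy]
    | tmul u v => simp

/-- `r₍₂₎ ◀ S⁻¹(s₍₁₎) ⊗ (s₍₂₎ ▶ (r₍₁₎ w)) = r₍₂₎ ⊗ r₍₁₎ (s ▶ w)` -/
theorem spread_ractAInv (s : B) (r w : A) : P.spread P.ractAInv.flip s (HA.cop.T₁ (r ⊗ₜ w)) =
    HA.cop.T₁ (r ⊗ₜ P.lactA s w) := by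
  apply eq_of_sliceL _ P.eq_zero_of_form_flip
  intro b
  rw [sliceL_cop_T₁, ← lactA_antipode_T₂]
  obtain ⟨n, p, q, hn⟩ := TensorProduct.exists_sum_tmul_eq (HA.cop.T₁ (r ⊗ₜ[K] w))
  have h1 : ∀ x, P.lactA x r * w = ∑ i, P.form (p i) x • q i := by
    intro x
    rw [← sliceL_cop_T₁, hn]
    simp
  have h2 : ∀ p q, sliceL (P.form.flip b) (P.spread P.ractAInv.flip s (p ⊗ₜ q)) =
      sliceL (P.form p ∘ₗ HB.antipode.symm.toLinearMap) ((P.lactA.flip q).lTensor B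
        (HB.T₂ (HB.antipode b ⊗ₜ s))) := by
    intro p q
    have h3 := lTensor_mulLeft_cop_leg P.swap P.isUnitalAction_lactA (HB.antipode b) s q
    rw [← sliceR_comm (P.form p ∘ₗ HB.antipode.symm.toLinearMap), ← h3, spread_tmul]
    generalize HB.cop.leg P.lactA (s ⊗ₜ[K] q) = t
    induction t with
    | zero => simp
    | add x y hx hy => simp only [map_add, hx, hy]
    | tmul u v => simp [ractAInv, HB.antipode_symm_mul, ← P.form_mul_right']
  have h4 : ∀ t : B ⊗[K] B, ∑ i, sliceL (P.form (p i) ∘ₗ HB.antipode.symm.toLinearMap)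
      ((P.lactA.flip (q i)).lTensor B t) = TensorProduct.lift (P.lactA.flip ∘ₗ
        LinearMap.mulRight K w ∘ₗ P.lactA.flip r ∘ₗ HB.antipode.symm.toLinearMap) t := by
    intro t
    induction t with
    | zero => simp
    | add x y hx hy => simp only [map_add, Finset.sum_add_distrib, hx, hy]
    | tmul u v => simp [h1]
  rw [← h4, hn]
  simp only [map_sum, h2]

/-- `r ⊗ s ⊗ q ↦ r ⊗ s₍₁₎ ⊗ (s₍₂₎ ▶ q)` -/
noncomputable def spreadLast : (A ⊗[K] B) ⊗[K] A →ₗ[K] (A ⊗[K] B) ⊗[K] A :=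
  (TensorProduct.assoc K A B A).symm.toLinearMap ∘ₗ
    ((TensorProduct.comm K A B).toLinearMap ∘ₗ HB.cop.leg P.lactA).lTensor A ∘ₗ
    (TensorProduct.assoc K A B A).toLinearMap

/-- `b₍₁₎ ▶ p ⊗ b₍₂₎ ⊗ b₍₃₎ ▶ q`, by coassociativity -/
theorem spread_leg (b : B) (t : A ⊗[K] A) :
    P.spread (TensorProduct.curry (HB.leg P.lactA)).flip b t =
      P.spreadLast ((HB.leg P.lactA ∘ₗ TensorProduct.mk K B A b).rTensor A t) := by
  induction t with
  | zero => simp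
  | add x y hx hy => simp only [map_add, hx, hy]
  | tmul p q =>
    exact leg_cop_leg P.swap P.isUnitalAction_lactA P.isUnitalAction_lactA b p q

/-- `b₍₁₎ ▶ a₍₂₎ ⊗ b₍₂₎ ⊗ a₍₁₎ w = (b₍₁₎ ▶ a)₍₂₎ ⊗ b₍₂₎ ⊗ (b₍₁₎ ▶ a)₍₁₎ w` -/
theorem rTensor_leg_cop_T₁ (b : B) (a w : A) :
    (HB.leg P.lactA ∘ₗ TensorProduct.mk K B A b).rTensor A (HA.cop.T₁ (a ⊗ₜ w)) =
      TensorProduct.rightComm K A A B ((HA.cop.T₁.toLinearMap ∘ₗ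
        (TensorProduct.mk K A A).flip w).rTensor B (HB.leg P.lactA (b ⊗ₜ a))) := by
  rw [← LinearEquiv.symm_apply_eq]
  apply eq_of_sliceR _ P.eq_zero_of_form
  intro y
  have h1 : ∀ t : A ⊗[K] A, sliceR (P.form y) ((TensorProduct.rightComm K A A B).symm
      ((HB.leg P.lactA ∘ₗ TensorProduct.mk K B A b).rTensor A t)) =
      (P.lactA (P.lactB y b)).rTensor A t := by
    intro t
    induction t with
    | zero => simp
    | add x y hx hy => simp only [map_add, hx, hy]
    | tmul p q =>
      rw [LinearMap.rTensor_tmul, LinearMap.rTensor_tmul, LinearMap.comp_apply,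
        TensorProduct.mk_apply, ← sliceR_leg_B _ P.isUnitalAction_lactA]
      generalize HB.leg P.lactA (b ⊗ₜ[K] p) = s
      induction s with
      | zero => simp
      | add x y hx hy => simp only [map_add, TensorProduct.add_tmul, hx, hy]
      | tmul u v => simp [TensorProduct.smul_tmul']
  have h2 : ∀ t : A ⊗[K] B, sliceR (P.form y) ((HA.cop.T₁.toLinearMap ∘ₗ
      (TensorProduct.mk K A A).flip w).rTensor B t) =
      HA.cop.T₁ (sliceR (P.form y) t ⊗ₜ w) := by
    intro t
    induction t with
    | zero => simp
    | add x y hx hy => simp only [map_add, TensorProduct.add_tmul, hx, hy]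
    | tmul u v => simp [← TensorProduct.smul_tmul']
  rw [h1, h2, sliceR_leg_B _ P.isUnitalAction_lactA, cop_T₁_lactA]

/-- `r₍₂₎ ◀ S⁻¹(s₍₂₎) ⊗ s₍₁₎ ⊗ (s₍₃₎ ▶ (r₍₁₎ w)) = r₍₂₎ ⊗ s₍₁₎ ⊗ r₍₁₎ (s₍₂₎ ▶ w)` -/
theorem untwist_spreadLast (s : B) (r w : A) :
    P.untwist.rTensor A (P.spreadLast (TensorProduct.rightComm K A A B
      (HA.cop.T₁ (r ⊗ₜ w) ⊗ₜ s))) =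
    TensorProduct.rightComm K A A B ((HA.cop.T₁.toLinearMap ∘ₗ
      TensorProduct.mk K A A r).rTensor B (HB.cop.leg P.lactA (s ⊗ₜ w))) := by
  rw [← LinearEquiv.symm_apply_eq]
  apply eq_of_sliceR _ P.eq_zero_of_form
  intro y
  have h1 : ∀ t : A ⊗[K] A, sliceR (P.form y) ((TensorProduct.rightComm K A A B).symm
      (P.untwist.rTensor A (P.spreadLast (TensorProduct.rightComm K A A B (t ⊗ₜ s))))) =
      P.spread P.ractAInv.flip (P.ractB y s) t := by
    intro t
    induction t with
    | zero => simp
    | add x y hx hy => simp only [map_add, TensorProduct.add_tmul, hx, hy]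
    | tmul p q =>
      have h3 := P.swap.cop_leg_ractA P.isUnitalAction_lactA y s q
      simp only [swap] at h3
      rw [spread_tmul, h3]
      simp only [spreadLast, TensorProduct.rightComm_tmul, LinearMap.comp_apply,
        LinearEquiv.coe_coe, TensorProduct.assoc_tmul, LinearMap.lTensor_tmul]
      generalize HB.cop.leg P.lactA (s ⊗ₜ[K] q) = t
      induction t with
      | zero => simp
      | add x y hx hy => simp only [map_add, TensorProduct.tmul_add, hx, hy]
      | tmul u v =>
        simp only [TensorProduct.comm_tmul, TensorProduct.assoc_symm_tmul, LinearMap.rTensor_tmul,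
          LinearMap.lTensor_tmul, LinearMap.flip_apply, untwist_tmul]
        rw [← sliceR_cop_leg_B _ P.isUnitalAction_ractAInv]
        generalize HB.cop.leg P.ractAInv (v ⊗ₜ[K] p) = t
        induction t with
        | zero => simp
        | add x y hx hy => simp only [map_add, TensorProduct.add_tmul, hx, hy]
        | tmul u v => simp [TensorProduct.smul_tmul']
  have h2 : ∀ t : A ⊗[K] B, sliceR (P.form y) ((HA.cop.T₁.toLinearMap ∘ₗ
      TensorProduct.mk K A A r).rTensor B t) =
      HA.cop.T₁ (r ⊗ₜ sliceR (P.form y) t) := by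
    intro t
    induction t with
    | zero => simp
    | add x y hx hy => simp only [map_add, TensorProduct.tmul_add, hx, hy]
    | tmul u v => simp
  rw [h1, h2, sliceR_cop_leg_B _ P.isUnitalAction_lactA, spread_ractAInv]

end Spread

/-- A bilinear map `F` on `A × B` with values in the Heisenberg double is determined by the elements
`π(F(a₍₂₎, b₍₁₎)) (b₍₂₎ ▶ (a₍₁₎ w))`. -/
theorem lift_rep_spread_injective {F G : A →ₗ[K] B →ₗ[K] A ⊗[K] B}
    (h : ∀ b a w, TensorProduct.lift P.rep (P.spread F b (HA.cop.T₁ (a ⊗ₜ w))) =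
      TensorProduct.lift P.rep (P.spread G b (HA.cop.T₁ (a ⊗ₜ w)))) : F = G := by
  have h1 : ∀ b t, TensorProduct.lift P.rep (P.spread F b t) =
      TensorProduct.lift P.rep (P.spread G b t) := by
    intro b t
    obtain ⟨t, rfl⟩ := HA.cop.T₁.surjective t
    induction t with
    | zero => simp
    | add x y hx hy => simp only [map_add, hx, hy]
    | tmul a w => exact h b a w
  have h2 : ∀ p (t : A ⊗[K] B),
      TensorProduct.lift P.rep (TensorProduct.comm K A (A ⊗[K] B) ((F p).lTensor A t)) =
      TensorProduct.lift P.rep (TensorProduct.comm K A (A ⊗[K] B) ((G p).lTensor A t)) := by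
    intro p t
    obtain ⟨t, rfl⟩ := leg_surjective (flip_symm HB.cop_Δ) P.isUnitalAction_lactA t
    induction t with
    | zero => simp
    | add x y hx hy => simp only [map_add, hx, hy]
    | tmul b q => exact h1 b (p ⊗ₜ q)
  refine LinearMap.ext fun p => LinearMap.ext fun b => P.rep_injective (LinearMap.ext fun z => ?_)
  simpa using h2 p (z ⊗ₜ b)

/-- The commutation relation `b·(a·h) = (b₍₁₎ ▶ a ◀ S⁻¹(b₍₃₎))·(b₍₂₎·h)`. -/
theorem actB_actA (b : B) (a : A) (h : A ⊗[K] B) :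
    P.actB b (P.actA a h) = P.action (P.twist (b ⊗ₜ a)) h := by
  have key : P.actB.flip ∘ₗ P.actA.flip h = ((TensorProduct.curry (HB.leg P.lactA)).flip.compr₂
      P.untwist).compr₂ (P.action.flip h) := by
    apply P.lift_rep_spread_injective
    intro b a w
    -- Both sides are `b ▶ (a h(w))`.
    have h1 : ∀ t : A ⊗[K] A, TensorProduct.lift P.rep (P.spread (P.actB.flip ∘ₗ P.actA.flip h)
        b t) = P.lactA b (TensorProduct.lift (P.rep ∘ₗ P.actA.flip h) t) := by
      intro t
      induction t with
      | zero => simp only [map_zero]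
      | add x y hx hy => simp only [map_add, hx, hy]
      | tmul p q =>
        rw [spread_tmul]
        change _ = P.lactA b (P.rep (P.actA p h) q)
        rw [← P.isAdjointAction_actB.leg HB.cop_Δ P.isUnitalAction_lactA]
        generalize HB.cop.leg P.lactA (b ⊗ₜ[K] q) = t
        induction t with
        | zero => simp only [map_zero]
        | add x y hx hy => simp only [map_add, hx, hy]
        | tmul u v => simp
    have h2 : ∀ (t : (A ⊗[K] B) ⊗[K] A), TensorProduct.lift P.rep
        ((P.action.flip h).rTensor A t) = TensorProduct.lift (P.rep ∘ₗ P.action.flip h) t := by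
      intro t
      induction t with
      | zero => simp only [map_zero]
      | add x y hx hy => simp only [map_add, hx, hy]
      | tmul u v => simp
    have h3 : ∀ (r : A) (t : A ⊗[K] B), TensorProduct.lift (P.rep ∘ₗ P.action.flip h)
        (TensorProduct.rightComm K A A B ((HA.cop.T₁.toLinearMap ∘ₗ
          TensorProduct.mk K A A r).rTensor B t)) =
        r * TensorProduct.lift (P.rep ∘ₗ P.actB.flip h) (TensorProduct.comm K A B t) := by
      intro r t
      induction t with
      | zero => simp only [map_zero, mul_zero]
      | add x y hx hy => simp only [map_add, mul_add, hx, hy]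
      | tmul w s =>
        rw [TensorProduct.comm_tmul, TensorProduct.lift.tmul, LinearMap.comp_apply,
          LinearMap.flip_apply, ← lift_rep_actA, LinearMap.rTensor_tmul, LinearMap.comp_apply,
          TensorProduct.mk_apply, LinearEquiv.coe_coe]
        generalize HA.cop.T₁ (r ⊗ₜ[K] w) = t
        induction t with
        | zero => simp only [map_zero, TensorProduct.zero_tmul]
        | add x y hx hy => simp only [map_add, TensorProduct.add_tmul, hx, hy]
        | tmul p q => simp [action, composeAct_tmul]
    have h4 : ∀ t : A ⊗[K] B, TensorProduct.lift (P.rep ∘ₗ P.action.flip h)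
        (P.untwist.rTensor A (P.spreadLast (TensorProduct.rightComm K A A B
          ((HA.cop.T₁.toLinearMap ∘ₗ (TensorProduct.mk K A A).flip w).rTensor B t)))) =
        P.rep t (P.rep h w) := by
      intro t
      induction t with
      | zero => simp only [map_zero, LinearMap.zero_apply]
      | add x y hx hy => simp only [map_add, LinearMap.add_apply, hx, hy]
      | tmul r s =>
        have h5 := P.untwist_spreadLast s r w
        rw [LinearMap.rTensor_tmul, LinearMap.comp_apply, LinearMap.flip_apply,
          TensorProduct.mk_apply, LinearEquiv.coe_coe, h5, h3,
          P.isAdjointAction_actB.leg HB.cop_Δ P.isUnitalAction_lactA, rep_tmul]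
    rw [h1, lift_rep_actA, spread_compr₂, spread_compr₂, h2, spread_leg, rTensor_leg_cop_T₁, h4,
      lactA_mul_eq_rep]
  exact LinearMap.congr_fun (LinearMap.congr_fun key a) b

/-! ### The module algebra -/

theorem actB_surjective : Function.Surjective (TensorProduct.lift P.actB) := by
  have h1 : ∀ (t : A ⊗[K] B) (d : B), (HB.ad.flip d).lTensor A t ∈
      LinearMap.range (TensorProduct.lift P.actB) := by
    intro t d
    obtain ⟨t, rfl⟩ := leg_surjective HB.cop_Δ P.isUnitalAction_lactA t
    induction t with
    | zero => simp
    | add x y hx hy =>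
      rw [map_add, map_add]
      exact add_mem hx hy
    | tmul b v => exact ⟨b ⊗ₜ (v ⊗ₜ d), rfl⟩
  rw [← LinearMap.range_eq_top, eq_top_iff, ← TensorProduct.span_tmul_eq_top, Submodule.span_le]
  rintro _ ⟨v, c, rfl⟩
  obtain ⟨t, rfl⟩ := HB.ad_surjective c
  induction t with
  | zero => simp
  | add x y hx hy =>
    rw [map_add, TensorProduct.tmul_add]
    exact add_mem hx hy
  | tmul b d => simpa using h1 (v ⊗ₜ b) d

theorem actA_surjective : Function.Surjective (TensorProduct.lift P.actA) := by
  have h1 : ∀ (t : B ⊗[K] A) (x : A), TensorProduct.comm K B A ((HA.adInv.flip x).lTensor B t) ∈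
      LinearMap.range (TensorProduct.lift P.actA) := by
    intro t x
    obtain ⟨t, rfl⟩ := leg_surjective HA.cop_Δ P.isUnitalAction_ractBInv t
    induction t with
    | zero => simp
    | add x y hx hy =>
      rw [map_add, map_add, map_add]
      exact add_mem hx hy
    | tmul a b => exact ⟨a ⊗ₜ (x ⊗ₜ b), rfl⟩
  rw [← LinearMap.range_eq_top, eq_top_iff, ← TensorProduct.span_tmul_eq_top, Submodule.span_le]
  rintro _ ⟨c, v, rfl⟩
  obtain ⟨t, rfl⟩ := HA.adInv_surjective c
  induction t with
  | zero => simp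
  | add x y hx hy =>
    rw [map_add, TensorProduct.add_tmul]
    exact add_mem hx hy
  | tmul a x => simpa using h1 (v ⊗ₜ a) x

theorem action_doubleLeftMulB (b : B) (y k : A ⊗[K] B) :
    P.action (P.doubleLeftMulB b y) k = P.actB b (P.action y k) := by
  induction y with
  | zero => simp
  | add x y hx hy => simp only [map_add, LinearMap.add_apply, hx, hy]
  | tmul a d =>
    have h1 : ∀ t : A ⊗[K] B, P.action ((LinearMap.mulRight K d).lTensor A t) k =
        P.action t (P.actB d k) := by
      intro t
      induction t with
      | zero => simp
      | add x y hx hy => simp only [map_add, LinearMap.add_apply, hx, hy]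
      | tmul r s =>
        have := P.isAdjointAction_actB.mul P.rep_injective P.isUnitalAction_lactA.surjective
          P.lactA_mul_left s d k
        simp [action, composeAct_tmul, this]
    rw [doubleLeftMulB_tmul, h1, ← twist_tmul, ← actB_actA]
    rfl

theorem action_leftMulAct (a : A) (y k : A ⊗[K] B) :
    P.action (leftMulAct K A B a y) k = P.actA a (P.action y k) := by
  induction y with
  | zero => simp
  | add x y hx hy => simp only [map_add, LinearMap.add_apply, hx, hy]
  | tmul a' d =>
    exact P.isAdjointAction_actA.mul P.rep_injective HA.mul'_surjective
      (fun a b z => mul_assoc a b z) a a' _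

theorem action_doubleMul (x y k : A ⊗[K] B) :
    P.action (P.doubleMul x y) k = P.action x (P.action y k) := by
  induction x with
  | zero => simp
  | add x y hx hy => simp only [map_add, LinearMap.add_apply, hx, hy]
  | tmul a b =>
    rw [doubleMul, composeAct_tmul, action_leftMulAct, action_doubleLeftMulB]
    rfl

/-- `x·(r (y·k)) = (x₍₁₎·r) ((x₍₂₎ y)·k)`: for `x = a ⋈ b`, combine this property of the adjoint
actions of `A` and `B`. -/
theorem action_heisenbergMul (x y r k : A ⊗[K] B) :
    P.action x (P.heisenbergMul r (P.action y k)) = TensorProduct.lift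
      (P.heisenbergMul.compl₁₂ (P.action.flip r) (P.action.flip k)) (P.doubleT₁ (x ⊗ₜ y)) := by
  induction x with
  | zero => simp
  | add x x' hx hy => simp only [map_add, TensorProduct.add_tmul, LinearMap.add_apply, hx, hy]
  | tmul a b =>
    have hA := fun r y => P.isAdjointAction_actA.act_mul_leg (flip_symm HA.cop_Δ)
      (isUnitalAction_mul HA.cop) P.rep_injective P.rep_heisenbergMul
      (isUnitalAction_leftMulAct HA.toMultiplierHopfAlgebra) P.action_leftMulAct a y r k
    have hB := P.isAdjointAction_actB.act_mul_leg HB.cop_Δ P.isUnitalAction_lactA P.rep_injective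
      P.rep_heisenbergMul P.isUnitalAction_doubleLeftMulB P.action_doubleLeftMulB b y r k
    have h1 : ∀ t : (A ⊗[K] B) ⊗[K] B, TensorProduct.lift
        (P.heisenbergMul.compl₁₂ (P.action.flip r) (P.action.flip k))
        (TensorProduct.comm K (A ⊗[K] B) (A ⊗[K] B) (TensorProduct.assoc K (A ⊗[K] B) A B
          ((HA.leg (leftMulAct K A B)).rTensor B ((TensorProduct.assoc K A (A ⊗[K] B) B).symm
            (a ⊗ₜ t))))) =
        P.actA a (TensorProduct.lift
          (P.heisenbergMul.flip.compl₁₂ (P.action.flip k) (P.actB.flip r)) t) := by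
      intro t
      induction t with
      | zero => simp
      | add x y hx hy => simp only [map_add, TensorProduct.tmul_add, hx, hy]
      | tmul y b =>
        simp only [TensorProduct.lift.tmul, LinearMap.compl₁₂_apply, LinearMap.flip_apply, ← hA,
          TensorProduct.assoc_symm_tmul, LinearMap.rTensor_tmul]
        generalize HA.leg (leftMulAct K A B) (a ⊗ₜ[K] y) = s
        induction s with
        | zero => simp
        | add x y hx hy => simp only [map_add, TensorProduct.add_tmul, hx, hy]
        | tmul u v => simp [action, composeAct_tmul]
    have h2 : P.action (a ⊗ₜ b) (P.heisenbergMul r (P.action y k)) =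
      P.actA a (P.actB b (P.heisenbergMul r (P.action y k))) := rfl
    rw [h2, ← hB, ← h1]
    rfl

/-! ### Non-degeneracy and unitality -/

theorem heisenbergMul_eq_zero_left (r : A ⊗[K] B) (h : ∀ s, P.heisenbergMul r s = 0) : r = 0 := by
  apply P.rep_injective
  rw [map_zero]
  refine LinearMap.ext fun z => ?_
  have h1 : ∀ a b y, P.rep r (a * P.lactA b y) = 0 := by
    intro a b y
    have h2 := P.rep_heisenbergMul r (a ⊗ₜ b)
    rw [h, map_zero] at h2
    exact (LinearMap.congr_fun h2 y).symm
  obtain ⟨t, rfl⟩ := HA.mul'_surjective z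
  induction t with
  | zero => simp
  | add x y hx hy => simpa [hx] using hy
  | tmul a w =>
    obtain ⟨t, rfl⟩ := P.lactA_surjective w
    induction t with
    | zero => simp
    | add x y hx hy =>
      rw [LinearMap.mul'_apply] at hx hy
      simp only [map_add, LinearMap.mul'_apply, mul_add, hx, hy, LinearMap.zero_apply, add_zero]
    | tmul b y => exact h1 a b y

theorem heisenbergMul_eq_zero_right (s : A ⊗[K] B) (h : ∀ r, P.heisenbergMul r s = 0) :
    s = 0 := by
  apply P.rep_injective
  rw [map_zero]
  refine LinearMap.ext fun y => ?_
  have h1 : ∀ b, P.lactA b (P.rep s y) = 0 := by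
    intro b
    refine HA.nondegenerate.2 _ fun a => ?_
    have h2 := P.rep_heisenbergMul (a ⊗ₜ b) s
    rw [h, map_zero] at h2
    exact (LinearMap.congr_fun h2 y).symm
  apply P.eq_zero_of_form_flip
  intro b
  obtain ⟨t, rfl⟩ := HB.mul'_surjective b
  induction t with
  | zero => simp
  | add x y hx hy => rw [map_add, map_add, LinearMap.add_apply, hx, hy, add_zero]
  | tmul b b' =>
    rw [LinearMap.mul'_apply, LinearMap.flip_apply, form_mul_right, h1, map_zero,
      LinearMap.zero_apply]

theorem span_action : Submodule.span K {r | ∃ x s, r = P.action x s} = ⊤ := by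
  rw [eq_top_iff]
  rintro r -
  obtain ⟨t, rfl⟩ := P.actA_surjective r
  induction t with
  | zero => simp
  | add x y hx hy =>
    rw [map_add]
    exact add_mem hx hy
  | tmul a r =>
    obtain ⟨t, rfl⟩ := P.actB_surjective r
    induction t with
    | zero => simp
    | add x y hx hy =>
      rw [map_add, TensorProduct.tmul_add, map_add]
      exact add_mem hx hy
    | tmul b s => exact Submodule.subset_span ⟨a ⊗ₜ b, s, rfl⟩

end Pairing

end MultiplierHopf

theorem proposition3p4 {K A B : Type*} [Field K]
    [NonUnitalRing A] [Module K A] [IsScalarTower K A A] [SMulCommClass K A A]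
    [NonUnitalRing B] [Module K B] [IsScalarTower K B B] [SMulCommClass K B B]
    (HA : MultiplierHopf.RegularMultiplierHopfAlgebra K A)
    (HB : MultiplierHopf.RegularMultiplierHopfAlgebra K B)
    (P : MultiplierHopf.Pairing HA HB) :
    MultiplierHopf.IsModuleAlgebra P.doubleMul P.doubleT₁ P.heisenbergMul P.action where
  mul_assoc r s t := P.rep_injective (by simp only [P.rep_heisenbergMul, mul_assoc])
  nondegenerate_left := P.heisenbergMul_eq_zero_left
  nondegenerate_right := P.heisenbergMul_eq_zero_right
  act_mul := P.action_doubleMul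
  unital := P.span_action
  act_mulR x y r s := P.action_heisenbergMul x y r s
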